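/- **Setting.** Let $\mathcal H$ be a separable complex Hilbert space, $\mathcal E\subseteq B(\mathcal H)$ a unital $C^*$-algebra, and let $\mathcal E_{[s,t]}\subseteq\mathcal E$ ($s\le t$) be unital $*$-subalgebras with $\mathcal E_{[s',t']}\subseteq\mathcal E_{[s,t]}$ whenever $[s',t']\subseteq[s,t]$. Put $\mathcal E_{\ge t}:=\overline{\bigvee_{t'>t}\mathcal E_{[t,t']}}^{\|\cdot\|}$, write $\mathcal A^-$ for the closure of $\mathcal A$ in the weak operator topology, and let $\mathcal E_\infty:=\bigcap_{t\in\mathbb R}\mathcal E_{\ge t}^-$. Let $\mathcal X$ be a finite set and, for every $t\in\mathbb R$, let $(\Pi_\xi(t))_{\xi\in\mathcal X}$ be commuting orthogonal projections in $\mathcal E_{\ge t}$ with $\sum_{\xi}\Pi_\xi(t)=\mathbf 1$. Fix times $t_1<t_2<\cdots$ and put $\Pi_{\underline\xi^{(m,n)}}:=\Pi_{\xi_m}(t_m)\cdots\Pi_{\xi_n}(t_n)$ for $m\le n$ and $\Pi_{\underline\xi^{(m,n)}}:=\mathbf 1$ for $m>n$. Assume * (ideal decoherence) for all $1\le m\le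 i\le n$ and all $\underline\xi$, $$\sum_{\xi_i\in\mathcal X}\Pi_{\underline\xi^{(m,n)}}\Pi_{\underline\xi^{(m,n)}}^{*}=\big(\Pi_{\underline\xi^{(m,i-1)}}\Pi_{\underline\xi^{(i+1,n)}}\big)\big(\Pi_{\underline\xi^{(m,i-1)}}\Pi_{\underline\xi^{(i+1,n)}}\big)^{*};$$ * (asymptotic abelianness) every operator in $\mathcal E_\infty$ commutes with every operator in $\mathcal E^-$. Let $\Xi:=\mathcal X^{\mathbb N}$ be the space of histories with its cylinder $\sigma$-algebra $\Sigma$, let $\Sigma_n$ be the $\sigma$-algebra of the events that depend only on the outcomes $\xi_{n+1},\xi_{n+2},\dots$, and let $\Sigma_\infty:=\bigcap_n\Sigma_n$ be the tail $\sigma$-algebra. For a normal state $\omega$ on $\mathcal E^-$ let $\mu_\omega$ be the probability measure on $(\Xi,\Sigma)$ with $$\mu_\omega\{\underline\eta:\eta_i=\xi_i,\ 1\le i\le n\}=\omega\big(\Pi_{\underline\xi^{(1,n)}}\Pi_{\underline\xi^{(1,n)}}^{*}\big)\qquad\text{for all } n \text{ and } \underline\xi .$$ A probability measure $\mu$ on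 $\Sigma$ is called $\Sigma_\infty$-ergodic if $\mu(\Lambda)\in\{0,1\}$ for every $\Lambda\in\Sigma_\infty$. **Theorem.** 1. There are a measurable space $(\Xi^\infty,\Sigma^\infty)$ and a measurable family $(\mu(\cdot|\nu))_{\nu\in\Xi^\infty}$ of mutually singular, $\Sigma_\infty$-ergodic probability measures on $(\Xi,\Sigma)$ such that for every normal state $\omega$ on $\mathcal E^-$ there is a probability measure $P^\infty_\omega$ on $\Sigma^\infty$ with $$\mu_\omega=\int_{\Xi^\infty}\mu(\cdot|\nu)\,dP^\infty_\omega(\nu).$$ 2. Moreover, such a decomposition can be chosen as a disintegration over the tail $\sigma$-algebra if the components are allowed to depend on $\omega$. There are a set $\Xi^\infty$ and a map $p:\Xi\to\Xi^\infty$ such that, with $\Sigma^\infty:=\{E\subseteq\Xi^\infty: p^{-1}(E)\in\Sigma_\infty\}$, the following holds for every normal state $\omega$ on $\mathcal E^-$. There is a measurable family $(\mu_\omega(\cdot|\nu))_{\nu\in\Xi^\infty}$ of mutually singular, $\Sigma_\infty$-ergodic probability measures on $(\Xi,\Sigma)$ such that, with the probability measure $P_\omega^\infty:=\mu_\omega\circ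 p^{-1}$ on $\Sigma^\infty$, $$\mu_\omega=\int_{\Xi^\infty}\mu_\omega(\cdot|\nu)\,dP^\infty_\omega(\nu),\qquad \mu_\omega(\Delta\cap\Lambda)=\int_{\Lambda}\mu_\omega(\Delta|p(\underline\xi))\,d\mu_\omega(\underline\xi)\quad\text{for all }\Delta\in\Sigma,\ \Lambda\in\Sigma_\infty .$$ -/

import Mathlib

open MeasureTheory ProbabilityTheory Filter Topology

namespace IndirectMeasurement

section Histories

variable {X : Type*}

/-- The set of histories that agree with `ξ` in the first `n` outcomes. -/
def cylinder (ξ : ℕ → X) (n : ℕ) : Set (ℕ → X) := {η | ∀ i < n, η i = ξ i}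

variable [MeasurableSpace X]

/-- The σ-algebra generated by the sets `X ^ n × C`, with `C` measurable in the space of
histories: the events that do not depend on the first `n` outcomes. -/
abbrev sigmaFrom (X : Type*) [MeasurableSpace X] (n : ℕ) : MeasurableSpace (ℕ → X) :=
  MeasurableSpace.comap (fun (ξ : ℕ → X) (i : ℕ) => ξ (n + i)) inferInstance

/-- The tail σ-algebra of the space of histories. -/
abbrev tailSigma (X : Type*) [MeasurableSpace X] : MeasurableSpace (ℕ → X) :=
  ⨅ n, sigmaFrom X n

/-- Every tail event has measure zero or one. -/
def TailErgodic (μ : Measure (ℕ → X)) : Prop :=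
  ∀ Λ : Set (ℕ → X), MeasurableSet[tailSigma X] Λ → μ Λ = 0 ∨ μ Λ = 1

lemma measurableSet_cylinder [MeasurableSingletonClass X] (ξ : ℕ → X) (n : ℕ) :
    MeasurableSet (cylinder ξ n) := by
  have : cylinder ξ n = ⋂ i, ⋂ (_ : i < n), (fun η : ℕ → X => η i) ⁻¹' {ξ i} := by
    ext η; simp [cylinder]
  rw [this]
  exact MeasurableSet.iInter fun i => MeasurableSet.iInter fun _ =>
    measurable_pi_apply i (measurableSet_singleton _)

/-- Consistent non-negative weights on cylinders are the values of a probability measure. -/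
lemma exists_measure_of_weights [Fintype X] [DecidableEq X] [Nonempty X]
    [DiscreteMeasurableSpace X]
    (w : (ℕ → X) → ℕ → ℝ) (w_nonneg : ∀ ξ n, 0 ≤ w ξ n) (w_zero : ∀ ξ, w ξ 0 = 1)
    (w_congr : ∀ ξ η n, (∀ i < n, ξ i = η i) → w ξ n = w η n)
    (w_sum : ∀ ξ n, ∑ x, w (Function.update ξ n x) (n + 1) = w ξ n) :
    ∃ μ : Measure (ℕ → X), IsProbabilityMeasure μ ∧
      ∀ ξ n, μ (cylinder ξ n) = ENNReal.ofReal (w ξ n) := by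
  classical
  obtain ⟨x₀⟩ := ‹Nonempty X›
  -- measures with the right values on cylinders of length at most `N`
  have step : ∀ N : ℕ, ∃ μ : Measure (ℕ → X), IsProbabilityMeasure μ ∧
      ∀ n ≤ N, ∀ ξ, μ (cylinder ξ n) = ENNReal.ofReal (w ξ n) := by
    intro N
    let ex : (Fin N → X) → (ℕ → X) := fun v i => if h : i < N then v ⟨i, h⟩ else x₀
    let μ : Measure (ℕ → X) :=
      ∑ v : Fin N → X, ENNReal.ofReal (w (ex v) N) • Measure.dirac (ex v)
    have top : ∀ ξ, μ (cylinder ξ N) = ENNReal.ofReal (w ξ N) := by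
      intro ξ
      have h1 : μ (cylinder ξ N) = ∑ v : Fin N → X, ENNReal.ofReal (w (ex v) N) *
          (cylinder ξ N).indicator 1 (ex v) := by
        simp only [μ, Measure.finsetSum_apply, Measure.smul_apply, smul_eq_mul]
        refine Finset.sum_congr rfl fun v _ => ?_
        rw [Measure.dirac_apply' _ (measurableSet_cylinder ξ N)]
      rw [h1, Finset.sum_eq_single (fun i : Fin N => ξ i)]
      · have hmem : ex (fun i : Fin N => ξ i) ∈ cylinder ξ N := by
          intro i hi
          simp [ex, hi]
        rw [Set.indicator_of_mem hmem, Pi.one_apply, mul_one, w_congr _ ξ N hmem]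
      · intro v _ hv
        have hnot : ex v ∉ cylinder ξ N := by
          intro hmem
          apply hv
          funext i
          have := hmem i i.2
          simpa [ex] using this
        rw [Set.indicator_of_notMem hnot, mul_zero]
      · simp
    have all : ∀ k ≤ N, ∀ ξ, μ (cylinder ξ (N - k)) = ENNReal.ofReal (w ξ (N - k)) := by
      intro k
      induction k with
      | zero => intro _ ξ; simpa using top ξ
      | succ k ih =>
        intro hk ξ
        obtain ⟨m, hm⟩ : ∃ m, N - (k + 1) = m := ⟨_, rfl⟩
        have hm' : N - k = m + 1 := by omega
        rw [hm]
        rw [hm'] at ih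
        have hU : cylinder ξ m =
            ⋃ x ∈ (Finset.univ : Finset X), cylinder (Function.update ξ m x) (m + 1) := by
          ext η
          simp only [cylinder, Set.mem_ofPred_eq, Finset.mem_univ, Set.iUnion_true,
            Set.mem_iUnion]
          constructor
          · intro h
            refine ⟨η m, fun i hi => ?_⟩
            rcases Nat.lt_succ_iff_lt_or_eq.1 hi with h' | rfl
            · rw [Function.update_of_ne h'.ne, h i h']
            · simp
          · rintro ⟨x, h⟩ i hi
            rw [h i (by omega), Function.update_of_ne hi.ne]
        rw [hU, measure_biUnion_finset]
        · rw [Finset.sum_congr rfl fun x _ => ih (by omega) (Function.update ξ m x),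
            ← ENNReal.ofReal_sum_of_nonneg fun x _ => w_nonneg _ _, w_sum]
        · intro x _ y _ hxy
          refine Set.disjoint_left.2 fun η hx hy => hxy ?_
          have h1 := hx m (by omega)
          have h2 := hy m (by omega)
          simp only [Function.update_self] at h1 h2
          exact h1.symm.trans h2
        · exact fun x _ => measurableSet_cylinder _ _
    have all' : ∀ n ≤ N, ∀ ξ, μ (cylinder ξ n) = ENNReal.ofReal (w ξ n) := by
      intro n hn ξ
      have := all (N - n) (by omega) ξ
      rwa [Nat.sub_sub_self hn] at this
    refine ⟨μ, ⟨?_⟩, all'⟩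
    have := all' 0 (by omega) (fun _ => x₀)
    rw [w_zero, ENNReal.ofReal_one] at this
    rw [← this]
    congr 1
    ext η
    simp [cylinder]
  choose μ hprob hμ using step
  let _ : TopologicalSpace X := ⊥
  have : DiscreteTopology X := ⟨rfl⟩
  have : BorelSpace X := inferInstance
  let ν : ℕ → ProbabilityMeasure (ℕ → X) := fun N => ⟨μ N, hprob N⟩
  obtain ⟨ρ, -, hρ⟩ := (isCompact_univ (X := ProbabilityMeasure (ℕ → X))).ultrafilter_le_nhds
    ((hyperfilter ℕ).map ν) (by simp)
  refine ⟨ρ, inferInstance, fun ξ n => ?_⟩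
  have hclopen : IsClopen (cylinder ξ n) := by
    have : cylinder ξ n = ⋂ i ∈ Finset.range n, (fun η : ℕ → X => η i) ⁻¹' {ξ i} := by
      ext η; simp [cylinder]
    rw [this]
    exact isClopen_biInter_finset fun i _ =>
      (isClopen_discrete {ξ i}).preimage (continuous_apply i)
  have ht : Tendsto ν (hyperfilter ℕ : Filter ℕ) (𝓝 ρ) := hρ
  have h1 := ProbabilityMeasure.tendsto_measure_of_null_frontier_of_tendsto' ht
    (E := cylinder ξ n) (by simp [hclopen.frontier_eq])
  have h2 : Tendsto (fun N => (ν N : Measure (ℕ → X)) (cylinder ξ n))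
      (hyperfilter ℕ : Filter ℕ) (𝓝 (ENNReal.ofReal (w ξ n))) := by
    refine tendsto_const_nhds.congr' ?_
    have : ∀ᶠ N in (hyperfilter ℕ : Filter ℕ), n ≤ N :=
      Nat.hyperfilter_le_atTop (eventually_ge_atTop n)
    filter_upwards [this] with N hN
    exact (hμ N n hN ξ).symm
  exact tendsto_nhds_unique h1 h2

end Histories

section Systems

variable {H : Type*} [NormedAddCommGroup H] [InnerProductSpace ℂ H] [CompleteSpace H]

/-- The closure, in the weak operator topology, of a `*`-algebra of bounded operators. -/
noncomputable def weakClosure (A : StarSubalgebra ℂ (H →L[ℂ] H)) : Submodule ℂ (H →WOT[ℂ] H) :=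
  (A.toSubalgebra.toSubmodule.map
    (ContinuousLinearMapWOT.linearEquiv ℂ :
      (H →WOT[ℂ] H) ≃ₗ[ℂ] (H →L[ℂ] H)).symm.toLinearMap).topologicalClosure

lemma ofCLM_mem_weakClosure {A : StarSubalgebra ℂ (H →L[ℂ] H)} {T : H →L[ℂ] H} (hT : T ∈ A) :
    ContinuousLinearMapWOT.ofCLM T ∈ weakClosure A :=
  Submodule.le_topologicalClosure _ ⟨T, hT, rfl⟩

/-- A normal state on the weak closure of `A`: a normalized positive linear functional whose
restriction to norm-bounded sets is continuous in the weak operator topology (on bounded sets the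
weak and the σ-weak operator topologies coincide). -/
structure NormalState (A : StarSubalgebra ℂ (H →L[ℂ] H)) where
  toLinearMap : weakClosure A →ₗ[ℂ] ℂ
  nonneg : ∀ T : weakClosure A, (T : H →WOT[ℂ] H).toCLM.IsPositive →
    0 ≤ (toLinearMap T).re ∧ (toLinearMap T).im = 0
  map_one : toLinearMap ⟨ContinuousLinearMapWOT.ofCLM 1, ofCLM_mem_weakClosure (one_mem A)⟩ = 1
  normal : ∀ r : ℝ,
    ContinuousOn toLinearMap {T : weakClosure A | ‖(T : H →WOT[ℂ] H).toCLM‖ ≤ r}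

/-- A physical system, represented on the Hilbert space `H`, that is monitored by one instrument
with outcomes in `X`, triggered at the times `time 0 < time 1 < ⋯`. -/
structure MonitoredSystem (H : Type*) [NormedAddCommGroup H] [InnerProductSpace ℂ H]
    [CompleteSpace H] (X : Type*) [Fintype X] where
  /-- The C⋆-algebra generated by the observables of the system. -/
  observables : StarSubalgebra ℂ (H →L[ℂ] H)
  isClosed_observables : IsClosed (observables : Set (H →L[ℂ] H))
  /-- The algebra generated by the observables measurable in the time interval `[s, t]`. -/
  localObservables : ℝ → ℝ → StarSubalgebra ℂ (H →L[ℂ] H)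
  local_mono : ∀ {s s' t' t : ℝ}, s ≤ s' → s' ≤ t' → t' ≤ t →
    localObservables s' t' ≤ localObservables s t
  local_le : ∀ {s t : ℝ}, s ≤ t → localObservables s t ≤ observables
  /-- The projection that represents the outcome `ξ` of the instrument at time `t`. -/
  proj : ℝ → X → (H →L[ℂ] H)
  isStarProjection_proj : ∀ t ξ, IsStarProjection (proj t ξ)
  proj_commute : ∀ t ξ η, Commute (proj t ξ) (proj t η)
  sum_proj : ∀ t, ∑ ξ, proj t ξ = 1
  /-- The projections at time `t` lie in the algebra of observables at times after `t`. -/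
  proj_mem : ∀ t ξ, proj t ξ ∈ (⨆ t' ∈ Set.Ioi t, localObservables t t').topologicalClosure
  time : ℕ → ℝ
  strictMono_time : StrictMono time

namespace MonitoredSystem

variable {X : Type*} [Fintype X] (S : MonitoredSystem H X)

/-- The norm-closed algebra generated by all observables measurable at times `≥ t`. -/
noncomputable def observablesFrom (t : ℝ) : StarSubalgebra ℂ (H →L[ℂ] H) :=
  (⨆ t' ∈ Set.Ioi t, S.localObservables t t').topologicalClosure

/-- The algebra of asymptotic observables. -/
noncomputable def asymptoticObservables : Submodule ℂ (H →WOT[ℂ] H) :=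
  ⨅ t : ℝ, weakClosure (S.observablesFrom t)

/-- The product, from left to right, of the projections that represent the outcomes
`ξ m, …, ξ (n - 1)`; it is `1` if `n ≤ m`. -/
noncomputable def stretch (ξ : ℕ → X) (m n : ℕ) : H →L[ℂ] H :=
  ((List.Ico m n).map fun i => S.proj (S.time i) (ξ i)).prod

/-- Summing over the outcome of one measurement amounts to omitting that measurement. -/
def IdealDecoherence [DecidableEq X] : Prop :=
  ∀ (ξ : ℕ → X) (m i n : ℕ), m ≤ i → i < n →
    ∑ x, S.stretch (Function.update ξ i x) m n * star (S.stretch (Function.update ξ i x) m n) =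
      (S.stretch ξ m i * S.stretch ξ (i + 1) n) * star (S.stretch ξ m i * S.stretch ξ (i + 1) n)

/-- The asymptotic observables commute with all elements of the weak closure of the algebra
of observables. -/
def AsymptoticallyAbelian : Prop :=
  ∀ T ∈ S.asymptoticObservables, ∀ B ∈ weakClosure S.observables, Commute T B

lemma observablesFrom_le (t : ℝ) : S.observablesFrom t ≤ S.observables :=
  StarSubalgebra.topologicalClosure_minimal
    (iSup₂_le fun _ ht' => S.local_le (le_of_lt ht')) S.isClosed_observables

lemma stretch_mem (ξ : ℕ → X) (m n : ℕ) : S.stretch ξ m n ∈ S.observables := by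
  refine list_prod_mem fun T hT => ?_
  obtain ⟨i, -, rfl⟩ := List.mem_map.1 hT
  exact S.observablesFrom_le _ (S.proj_mem _ _)

/-- The operator `Π Π⋆`, where `Π` is the product of the projections that represent the first `n`
outcomes of the history `ξ`, as an element of the weak closure of the algebra of observables. -/
noncomputable def historyEffect (ξ : ℕ → X) (n : ℕ) : weakClosure S.observables :=
  ⟨ContinuousLinearMapWOT.ofCLM (S.stretch ξ 0 n * star (S.stretch ξ 0 n)),
    ofCLM_mem_weakClosure (mul_mem (S.stretch_mem ξ 0 n) (star_mem (S.stretch_mem ξ 0 n)))⟩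

lemma sum_historyEffect [DecidableEq X] (ξ : ℕ → X) (n : ℕ) :
    ∑ x, S.historyEffect (Function.update ξ n x) (n + 1) = S.historyEffect ξ n := by
  apply Subtype.ext
  apply ContinuousLinearMapWOT.toCLM_injective
  have h0 : ∀ x, S.stretch (Function.update ξ n x) 0 (n + 1) =
      S.stretch ξ 0 n * S.proj (S.time n) x := by
    intro x
    unfold stretch
    rw [List.Ico.succ_top (Nat.zero_le n), List.map_append, List.prod_append]
    congr 1
    · congr 1
      refine List.map_congr_left fun i hi => ?_
      rw [Function.update_of_ne (List.Ico.mem.1 hi).2.ne]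
    · simp
  have h1 : ∀ x, (S.stretch ξ 0 n * S.proj (S.time n) x) *
      star (S.stretch ξ 0 n * S.proj (S.time n) x) =
      S.stretch ξ 0 n * S.proj (S.time n) x * star (S.stretch ξ 0 n) := by
    intro x
    have hp := S.isStarProjection_proj (S.time n) x
    rw [star_mul, hp.isSelfAdjoint.star_eq, ← mul_assoc,
      mul_assoc (S.stretch ξ 0 n) _ (S.proj (S.time n) x), hp.isIdempotentElem.eq]
  have h2 : ∑ x, (S.stretch ξ 0 n * S.proj (S.time n) x) *
      star (S.stretch ξ 0 n * S.proj (S.time n) x) =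
      S.stretch ξ 0 n * star (S.stretch ξ 0 n) := by
    rw [Finset.sum_congr rfl fun x _ => h1 x, ← Finset.sum_mul, ← Finset.mul_sum,
      S.sum_proj, mul_one]
  have h3 : ((∑ x, S.historyEffect (Function.update ξ n x) (n + 1) :
      weakClosure S.observables) : H →WOT[ℂ] H).toCLM =
      ∑ x, (S.stretch ξ 0 n * S.proj (S.time n) x) *
        star (S.stretch ξ 0 n * S.proj (S.time n) x) := by
    rw [Submodule.coe_sum]
    change (ContinuousLinearMapWOT.linearEquiv ℂ) (∑ x, _) = _
    rw [map_sum]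
    refine Finset.sum_congr rfl fun x _ => ?_
    rw [← h0]
    rfl
  rw [h3, h2]
  rfl

/-- Existence of the measure on histories that is determined by the state `ω`. -/
lemma exists_historyMeasure [MeasurableSpace X] [DiscreteMeasurableSpace X]
    (ω : NormalState S.observables) :
    ∃ μ : Measure (ℕ → X), IsProbabilityMeasure μ ∧
      ∀ ξ n, μ (cylinder ξ n) = ENNReal.ofReal (ω.toLinearMap (S.historyEffect ξ n)).re := by
  classical
  have hne : Nonempty X := by
    by_contra hX
    have hX' : IsEmpty X := not_nonempty_iff.1 hX
    have h0 : (0 : H →L[ℂ] H) = 1 := by simpa using S.sum_proj 0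
    have h1 := ω.map_one
    have h2 : (⟨ContinuousLinearMapWOT.ofCLM 1, ofCLM_mem_weakClosure (one_mem S.observables)⟩ :
        weakClosure S.observables) = 0 := by
      apply Subtype.ext
      change ContinuousLinearMapWOT.ofCLM (1 : H →L[ℂ] H) = ContinuousLinearMapWOT.ofCLM 0
      rw [h0]
    rw [h2, map_zero] at h1
    exact zero_ne_one h1
  refine exists_measure_of_weights
    (fun ξ n => (ω.toLinearMap (S.historyEffect ξ n)).re) ?_ ?_ ?_ ?_
  · intro ξ n
    refine (ω.nonneg _ ?_).1
    exact ContinuousLinearMap.isPositive_self_comp_adjoint (S.stretch ξ 0 n)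
  · intro ξ
    have : S.historyEffect ξ 0 = ⟨ContinuousLinearMapWOT.ofCLM 1,
        ofCLM_mem_weakClosure (one_mem S.observables)⟩ := by
      apply Subtype.ext
      simp [historyEffect, stretch]
    simp only [this, ω.map_one, Complex.one_re]
  · intro ξ η n h
    have : S.stretch ξ 0 n = S.stretch η 0 n := by
      unfold stretch
      congr 1
      refine List.map_congr_left fun i hi => ?_
      rw [h i (List.Ico.mem.1 hi).2]
    have h' : S.historyEffect ξ n = S.historyEffect η n := by
      apply Subtype.ext
      simp only [historyEffect, this]
    simp only [h']
  · intro ξ n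
    rw [← Complex.re_sum, ← map_sum, S.sum_historyEffect]

/-- The measure on histories determined by the normal state `ω`: the probability that the first
`n` outcomes are those of `ξ` is `ω (Π Π⋆)`, with `Π` the product of the corresponding
projections. -/
noncomputable def historyMeasure [MeasurableSpace X] [DiscreteMeasurableSpace X]
    (ω : NormalState S.observables) : Measure (ℕ → X) :=
  (S.exists_historyMeasure ω).choose

instance [MeasurableSpace X] [DiscreteMeasurableSpace X] (ω : NormalState S.observables) :
    IsProbabilityMeasure (S.historyMeasure ω) :=
  (S.exists_historyMeasure ω).choose_spec.1

lemma historyMeasure_cylinder [MeasurableSpace X] [DiscreteMeasurableSpace X]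
    (ω : NormalState S.observables) (ξ : ℕ → X) (n : ℕ) :
    S.historyMeasure ω (cylinder ξ n) =
      ENNReal.ofReal (ω.toLinearMap (S.historyEffect ξ n)).re :=
  (S.exists_historyMeasure ω).choose_spec.2 ξ n

end MonitoredSystem

end Systems

end IndirectMeasurement

/-! The theorem becomes purely measure-theoretic once all measures `μ_ω` are dominated by one
probability measure `μ`. For the domination, take the vector states of a dense sequence of unit
vectors. A set `Δ` that is null for all of them is approximated by events `C n` of finitely many
outcomes. These are represented by effects `0 ≤ Q n ≤ 1` whose diagonal matrix elements tend to zero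
on the dense sequence. Hence `Q n → 0` weakly, and normality gives `μ_ω Δ = 0`
(`historyMeasure_eq_zero_of_vectorState`).

Conditioning on `⨅ n, B n` is delicate, because this σ-algebra need not be countably generated even
if every `B n` is. The conditional measures `K ξ` are nevertheless trivial on it for almost every
`ξ`. Under `K ξ`, conditioning on `B n` is still given by the kernel of `B n`, and reverse
martingale convergence drives these conditional probabilities of `Δ` to the constant `K ξ Δ`. Thus
every event is `K ξ`-independent of the intersection, which is therefore independent of itself.
Moreover `K η = K ξ` for `K ξ`-almost every `η`, so distinct components live on disjoint sets.
`exists_ergodic_disintegration` makes all this hold for every `ξ`.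

For components common to all states, `L¹(μ)` is separable, so countably many densities, collected in
a map `g`, determine all the others up to null sets. Once `g` is adjoined to the outcomes from `n`
on, every density is measurable for the intersection and comes out of the conditioning. For
components that depend on `ω`, those of `μ` over the tail are multiplied by the density and
normalized; absolute continuity preserves triviality and singularity. -/

namespace IndirectMeasurement

/-! ### Reverse martingales in mean -/

section ReverseMartingale

variable {Ω : Type*} {mΩ : MeasurableSpace Ω} {μ : Measure Ω} {B : ℕ → MeasurableSpace Ω}

/-- A function that is a.e. measurable with respect to every member of a decreasing sequence of
σ-algebras is a.e. measurable with respect to their intersection. -/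
lemma aestronglyMeasurable_iInf_of_antitone (hB : Antitone B) {f : Ω → ℝ}
    (hf : ∀ n, AEStronglyMeasurable[B n] f μ) : AEStronglyMeasurable[⨅ n, B n] f μ := by
  -- A limsup ignores finitely many terms, so it is measurable for every `B k`, hence for the
  -- intersection.
  refine ⟨fun x => limsup (fun n => (hf n).mk f x) atTop, ?_, ?_⟩
  · refine Measurable.stronglyMeasurable (mα := ⨅ n, B n) fun s hs => ?_
    rw [MeasurableSpace.measurableSet_iInf]
    intro k
    have h1 : Measurable[B k] fun x => limsup (fun n => (hf (n + k)).mk f x) atTop :=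
      Measurable.limsup fun n =>
        ((hf (n + k)).stronglyMeasurable_mk.measurable).mono (hB (Nat.le_add_left k n)) le_rfl
    have h2 : (fun x => limsup (fun n => (hf n).mk f x) atTop) =
        fun x => limsup (fun n => (hf (n + k)).mk f x) atTop := by
      funext x
      exact (limsup_nat_add (fun n => (hf n).mk f x) k).symm
    rw [h2]
    exact h1 hs
  · have : ∀ᵐ x ∂μ, ∀ n, f x = (hf n).mk f x := ae_all_iff.2 fun n => (hf n).ae_eq_mk
    filter_upwards [this] with x hx
    simp only [← hx, limsup_const]

/-- Mean convergence of reverse martingales. -/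
lemma tendsto_eLpNorm_condExp_iInf [IsProbabilityMeasure μ] (hB : Antitone B)
    (hle : ∀ n, B n ≤ mΩ) {f : Ω → ℝ} (hf : MemLp f 2 μ) :
    Tendsto (fun n => eLpNorm (μ[f | B n] - μ[f | ⨅ n, B n]) 1 μ) atTop (𝓝 0) := by
  have hC : ⨅ n, B n ≤ mΩ := (iInf_le B 0).trans (hle 0)
  have hfact : ∀ n, Fact (B n ≤ mΩ) := fun n => ⟨hle n⟩
  let V : ℕ → Submodule ℝ (Lp ℝ 2 μ) := fun n => lpMeas ℝ ℝ (B n) 2 μ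
  have hcompl : ∀ n, CompleteSpace (V n) := fun n => by
    simp only [V]; infer_instance
  have hproj : ∀ n, (V n).HasOrthogonalProjection := fun n => inferInstance
  have hVanti : Antitone V := fun n m hnm g hg => by
    simp only [V, mem_lpMeas_iff_aestronglyMeasurable] at hg ⊢
    exact hg.mono (hB hnm)
  -- The complements of the decreasing spaces `V n` increase, so their projections converge strongly
  -- to the projection onto the closure of their union. Subtracting from `φ` gives the limit `G` of
  -- the projections onto `V n`.
  let U : ℕ → Submodule ℝ (Lp ℝ 2 μ) := fun n => (V n)ᗮ
  have hU : Monotone U := fun n m hnm => Submodule.orthogonal_le (hVanti hnm)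
  let φ : Lp ℝ 2 μ := hf.toLp f
  let W := (⨆ n, U n).topologicalClosure
  have hW : CompleteSpace W := (Submodule.isClosed_topologicalClosure _).completeSpace_coe
  let G : Lp ℝ 2 μ := φ - W.starProjection φ
  have hlim : Tendsto (fun n => (V n).starProjection φ) atTop (𝓝 G) := by
    have h1 := (Submodule.starProjection_tendsto_closure_iSup U hU φ).const_sub φ
    refine h1.congr fun n => ?_
    simp [U, Submodule.starProjection_orthogonal]
  have hGV : ∀ n, G ∈ V n := fun n => by
    have hcl : IsClosed (V n : Set (Lp ℝ 2 μ)) :=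
      (completeSpace_coe_iff_isComplete.1 (hcompl n)).isClosed
    refine hcl.mem_of_tendsto hlim ?_
    filter_upwards [eventually_ge_atTop n] with m hm
    exact hVanti hm (Submodule.starProjection_apply_mem _ _)
  have : Fact (⨅ n, B n ≤ mΩ) := ⟨hC⟩
  let V' : Submodule ℝ (Lp ℝ 2 μ) := lpMeas ℝ ℝ (⨅ n, B n) 2 μ
  have hV'V : ∀ n, V' ≤ V n := fun n g hg => by
    simp only [V, V', mem_lpMeas_iff_aestronglyMeasurable] at hg ⊢
    exact hg.mono (iInf_le B n)
  have hGV' : G ∈ V' := by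
    rw [mem_lpMeas_iff_aestronglyMeasurable]
    exact aestronglyMeasurable_iInf_of_antitone hB fun n =>
      mem_lpMeas_iff_aestronglyMeasurable.1 (hGV n)
  have hcompl' : CompleteSpace V' := by
    simp only [V']; infer_instance
  have hWle : W ≤ V'ᗮ :=
    Submodule.topologicalClosure_minimal _
      (iSup_le fun n => Submodule.orthogonal_le (hV'V n)) (Submodule.isClosed_orthogonal _)
  have hG : V'.starProjection φ = G := by
    refine Submodule.eq_starProjection_of_mem_orthogonal hGV' ?_
    have : φ - G = W.starProjection φ := by simp [G]
    rw [this]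
    exact hWle (Submodule.starProjection_apply_mem _ _)
  have hn : ∀ n, (V n).starProjection φ =ᵐ[μ] μ[f | B n] := fun n =>
    hf.condExpL2_ae_eq_condExp (𝕜 := ℝ) (hle n)
  have hG' : G =ᵐ[μ] μ[f | ⨅ n, B n] := by
    rw [← hG]
    exact hf.condExpL2_ae_eq_condExp (𝕜 := ℝ) hC
  have h2 : Tendsto (fun n => eLpNorm (μ[f | B n] - μ[f | ⨅ n, B n]) 2 μ) atTop (𝓝 0) := by
    have h3 := (Lp.tendsto_Lp_iff_tendsto_eLpNorm' _ _).1 hlim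
    exact h3.congr fun n => eLpNorm_congr_ae ((hn n).sub hG')
  refine tendsto_of_tendsto_of_tendsto_of_le_of_le tendsto_const_nhds h2 (fun _ => zero_le) ?_
  intro n
  refine eLpNorm_le_eLpNorm_of_exponent_le (by norm_num) ?_
  exact (integrable_condExp.sub integrable_condExp).aestronglyMeasurable

end ReverseMartingale

/-! ### Conditional measures and the tower property -/

section ErgodicDecomposition

/-- The algebra of sets generated by a countable family is again countable. It serves to exchange
"almost every point" with "every event". -/
lemma exists_countable_isPiSystem {Ω : Type*} (m : MeasurableSpace Ω)
    (hm : @MeasurableSpace.CountablyGenerated Ω m) :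
    ∃ D : Set (Set Ω), D.Countable ∧ IsPiSystem D ∧ m = MeasurableSpace.generateFrom D := by
  obtain ⟨b, hb, rfl⟩ := hm.isCountablyGenerated
  refine ⟨generateSetAlgebra b, countable_generateSetAlgebra hb, ?_, ?_⟩
  · exact fun s hs t ht _ => isSetAlgebra_generateSetAlgebra.inter_mem hs ht
  · exact generateFrom_generateSetAlgebra_eq.symm

variable {Ω : Type*} {m m' : MeasurableSpace Ω} [mΩ : MeasurableSpace Ω] [StandardBorelSpace Ω]
  {μ : Measure Ω} [IsProbabilityMeasure μ]

/-- Drawing `ξ` from `μ` and then `η` from its conditional measure yields, on `m.prod mΩ`, the law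
of the diagonal pair `(ξ, ξ)`. -/
lemma lintegral_lintegral_condExpKernel (hm : m ≤ mΩ) {F : Ω × Ω → ENNReal}
    (hF : Measurable[m.prod mΩ] F) :
    ∫⁻ ξ, ∫⁻ η, F (ξ, η) ∂condExpKernel μ m ξ ∂μ = ∫⁻ ξ, F (ξ, ξ) ∂μ := by
  have h1 : Measurable[m] fun ξ => ∫⁻ η, F (ξ, η) ∂condExpKernel μ m ξ :=
    Measurable.lintegral_kernel_prod_right' hF
  rw [← lintegral_trim hm h1, ← Measure.lintegral_compProd hF, compProd_trim_condExpKernel hm]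
  exact @lintegral_map _ _ mΩ (m.prod mΩ) μ _ Function.diag hF
    (@Measurable.prodMk Ω mΩ Ω Ω m mΩ id id (measurable_id'' hm) measurable_id)

lemma setLIntegral_lintegral_condExpKernel (hm : m ≤ mΩ) {f : Ω → ENNReal} (hf : Measurable f)
    {Λ : Set Ω} (hΛ : MeasurableSet[m] Λ) :
    ∫⁻ ξ in Λ, ∫⁻ η, f η ∂condExpKernel μ m ξ ∂μ = ∫⁻ ξ in Λ, f ξ ∂μ := by
  have hF : Measurable[m.prod mΩ] fun z : Ω × Ω => Λ.indicator 1 z.1 * f z.2 := by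
    refine Measurable.mul ?_ (hf.comp measurable_snd)
    exact Measurable.comp (Measurable.indicator (m := m) (@measurable_const _ _ _ m 1) hΛ) measurable_fst
  have h := lintegral_lintegral_condExpKernel (μ := μ) hm hF
  rw [← lintegral_indicator (hm _ hΛ), ← lintegral_indicator (hm _ hΛ)]
  convert h using 2
  · funext ξ
    dsimp only
    rw [lintegral_const_mul _ hf]
    by_cases hξ : ξ ∈ Λ <;> simp [hξ]
  · funext ξ
    by_cases hξ : ξ ∈ Λ <;> simp [hξ]

lemma ae_condExpKernel_of_ae (hm : m ≤ mΩ) {p : Ω × Ω → Prop}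
    (hp : MeasurableSet[m.prod mΩ] {z | p z}) (h : ∀ᵐ ξ ∂μ, p (ξ, ξ)) :
    ∀ᵐ ξ ∂μ, ∀ᵐ η ∂condExpKernel μ m ξ, p (ξ, η) := by
  have hF : Measurable[m.prod mΩ] ({z | p z}ᶜ.indicator (1 : Ω × Ω → ENNReal)) :=
    Measurable.indicator (m := m.prod mΩ) (@measurable_const _ _ _ (m.prod mΩ) 1) hp.compl
  have h1 := lintegral_lintegral_condExpKernel (μ := μ) hm hF
  have h2 : ∫⁻ ξ, {z | p z}ᶜ.indicator (1 : Ω × Ω → ENNReal) (ξ, ξ) ∂μ = 0 := by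
    rw [lintegral_congr_ae (g := 0), Pi.zero_def, lintegral_zero]
    filter_upwards [h] with ξ hξ
    simp [hξ]
  rw [h2] at h1
  have h3 : Measurable[m] fun ξ => ∫⁻ η, {z | p z}ᶜ.indicator (1 : Ω × Ω → ENNReal) (ξ, η)
      ∂condExpKernel μ m ξ := Measurable.lintegral_kernel_prod_right' hF
  rw [lintegral_eq_zero_iff (h3.mono hm le_rfl)] at h1
  filter_upwards [h1] with ξ hξ
  have h4 : Measurable fun η => {z | p z}ᶜ.indicator (1 : Ω × Ω → ENNReal) (ξ, η) :=
    hF.comp (@measurable_prodMk_left _ _ m mΩ ξ)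
  have h5 := (lintegral_eq_zero_iff h4).1 hξ
  filter_upwards [h5] with η hη
  by_contra hcon
  simp [hcon] at hη

/-- Two conditional measures are equal once they agree on a countable π-system generating `mΩ`; no
countable generation of `m` is involved. -/
lemma measurableSet_condExpKernel_eq (hm : m ≤ mΩ) :
    MeasurableSet[m.prod mΩ]
      {z : Ω × Ω | condExpKernel μ m z.2 = condExpKernel μ m z.1} := by
  obtain ⟨D, hDc, hDπ, hD⟩ := exists_countable_isPiSystem mΩ inferInstance
  have hDm : ∀ Δ ∈ D, MeasurableSet Δ := fun Δ h => by
    rw [hD]; exact MeasurableSpace.measurableSet_generateFrom h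
  have : {z : Ω × Ω | condExpKernel μ m z.2 = condExpKernel μ m z.1} =
      ⋂ Δ ∈ D, {z : Ω × Ω | condExpKernel μ m z.2 Δ = condExpKernel μ m z.1 Δ} := by
    ext z
    simp only [Set.mem_ofPred_eq, Set.mem_iInter]
    refine ⟨fun h Δ _ => by rw [h], fun h => ?_⟩
    exact ext_of_generate_finite D hD hDπ h (by simp)
  rw [this]
  refine MeasurableSet.biInter hDc fun Δ hΔ => ?_
  refine measurableSet_eq_fun ?_ ?_
  · exact ((measurable_condExpKernel (hDm Δ hΔ)).mono hm le_rfl).comp measurable_snd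
  · exact Measurable.comp (measurable_condExpKernel (hDm Δ hΔ)) measurable_fst

/-- The relation is trivial on the diagonal and so passes to almost all pairs. This is the source of
mutual singularity. -/
lemma ae_ae_condExpKernel_eq (hm : m ≤ mΩ) :
    ∀ᵐ ξ ∂μ, ∀ᵐ η ∂condExpKernel μ m ξ, condExpKernel μ m η = condExpKernel μ m ξ :=
  ae_condExpKernel_of_ae hm (p := fun z => condExpKernel μ m z.2 = condExpKernel μ m z.1)
    (measurableSet_condExpKernel_eq hm) (ae_of_all _ fun _ => rfl)

/-- Conditioning first on a larger σ-algebra, then on a smaller one. -/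
lemma ae_condExpKernel_inter_eq (hmm' : m ≤ m') (hm' : m' ≤ mΩ)
    (hcg : @MeasurableSpace.CountablyGenerated Ω m') {Δ : Set Ω} (hΔ : MeasurableSet Δ) :
    ∀ᵐ ξ ∂μ, ∀ Λ, MeasurableSet[m'] Λ →
      condExpKernel μ m ξ (Δ ∩ Λ) = ∫⁻ η in Λ, condExpKernel μ m' η Δ ∂condExpKernel μ m ξ := by
  have hm := hmm'.trans hm'
  obtain ⟨D, hDc, hDπ, hD⟩ := exists_countable_isPiSystem m' hcg
  have hDm : ∀ Λ ∈ insert Set.univ D, MeasurableSet[m'] Λ := by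
    rintro Λ (rfl | h)
    · exact MeasurableSet.univ
    · rw [hD]; exact MeasurableSpace.measurableSet_generateFrom h
  have hmeas : Measurable fun η => condExpKernel μ m' η Δ :=
    (measurable_condExpKernel hΔ).mono hm' le_rfl
  have key : ∀ Λ ∈ insert Set.univ D, ∀ᵐ ξ ∂μ, condExpKernel μ m ξ (Δ ∩ Λ) =
      ∫⁻ η in Λ, condExpKernel μ m' η Δ ∂condExpKernel μ m ξ := by
    intro Λ hΛD
    have hΛ := hDm Λ hΛD
    have hf : Measurable (Λ.indicator fun η => condExpKernel μ m' η Δ) :=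
      hmeas.indicator (hm' _ hΛ)
    have hm1 : Measurable[m] fun ξ => condExpKernel μ m ξ (Δ ∩ Λ) :=
      measurable_condExpKernel (hΔ.inter (hm' _ hΛ))
    have hm2 : Measurable[m] fun ξ =>
        ∫⁻ η in Λ, condExpKernel μ m' η Δ ∂condExpKernel μ m ξ := by
      simp_rw [← lintegral_indicator (hm' _ hΛ)]
      exact Measurable.lintegral_kernel hf
    have : (fun ξ => condExpKernel μ m ξ (Δ ∩ Λ)) =ᵐ[μ.trim hm] fun ξ =>
        ∫⁻ η in Λ, condExpKernel μ m' η Δ ∂condExpKernel μ m ξ := by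
      -- Integrated over `M` in `m`, both sides equal `μ (Δ ∩ Λ ∩ M)`; for the right one, `Λ ∩ M`
      -- lies in `m'` and the kernel of `m'` applies.
      refine ae_eq_of_forall_setLIntegral_eq_of_sigmaFinite hm1 hm2 fun M hM _ => ?_
      rw [restrict_trim hm _ hM, lintegral_trim hm hm1, lintegral_trim hm hm2]
      have h1 := setLIntegral_lintegral_condExpKernel (μ := μ) hm
        (measurable_one.indicator (hΔ.inter (hm' _ hΛ))) hM
      have h2 := setLIntegral_lintegral_condExpKernel (μ := μ) hm hf hM
      have h3 := setLIntegral_lintegral_condExpKernel (μ := μ) hm'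
        (measurable_one.indicator hΔ) (hΛ.inter (hmm' _ hM))
      simp only [lintegral_indicator_one hΔ, lintegral_indicator_one (hΔ.inter (hm' _ hΛ)),
        lintegral_indicator (hm' _ hΛ)] at h1 h2 h3
      rw [h1, h2, Measure.restrict_restrict (hm' _ hΛ), h3,
        Measure.restrict_apply hΔ, Measure.restrict_apply (hΔ.inter (hm' _ hΛ)), Set.inter_assoc]
    exact ae_eq_of_ae_eq_trim this
  have key' := (ae_ball_iff (hDc.insert Set.univ)).2 key
  filter_upwards [key'] with ξ hξ
  -- For this `ξ` both sides are finite measures in `Λ` on `m'` that agree on the π-system `D` and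
  -- on the whole space, hence everywhere.
  let ν := condExpKernel μ m ξ
  let ρ₁ : @Measure Ω m' := (ν.restrict Δ).trim hm'
  let ρ₂ : @Measure Ω m' := (ν.withDensity fun η => condExpKernel μ m' η Δ).trim hm'
  have e1 : ∀ Λ, MeasurableSet[m'] Λ → ρ₁ Λ = ν (Δ ∩ Λ) := fun Λ hΛ => by
    rw [trim_measurableSet_eq hm' hΛ, Measure.restrict_apply (hm' _ hΛ), Set.inter_comm]
  have e2 : ∀ Λ, MeasurableSet[m'] Λ → ρ₂ Λ = ∫⁻ η in Λ, condExpKernel μ m' η Δ ∂ν := fun Λ hΛ => by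
    rw [trim_measurableSet_eq hm' hΛ, withDensity_apply _ (hm' _ hΛ)]
  have hρ : ρ₁ = ρ₂ := by
    refine ext_of_generate_finite D hD hDπ (fun Λ hΛ => ?_) ?_
    · rw [e1 _ (hDm _ (Set.mem_insert_of_mem _ hΛ)), e2 _ (hDm _ (Set.mem_insert_of_mem _ hΛ))]
      exact hξ Λ (Set.mem_insert_of_mem _ hΛ)
    · rw [e1 _ MeasurableSet.univ, e2 _ MeasurableSet.univ]
      exact hξ _ (Set.mem_insert _ _)
  intro Λ hΛ
  rw [← e1 _ hΛ, ← e2 _ hΛ, hρ]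

end ErgodicDecomposition

/-! ### The zero-one law for conditional measures -/

section ErgodicDecomposition

variable {Ω : Type*} {B : ℕ → MeasurableSpace Ω} [mΩ : MeasurableSpace Ω] [StandardBorelSpace Ω]
  {μ : Measure Ω} [IsProbabilityMeasure μ]

/-- By the tower property the left side is the integral over `Λ`, under the conditional measure at
`ξ`, of the conditional probability of `Δ` given `B n`. As `n` grows this integrand approaches, in
mean along a subsequence, a constant. The exceptional null set does not depend on `Λ`. -/
lemma ae_condExpKernel_iInf_inter_eq_mul (hB : Antitone B) (hle : ∀ n, B n ≤ mΩ)
    (hcg : ∀ n, @MeasurableSpace.CountablyGenerated Ω (B n)) {Δ : Set Ω} (hΔ : MeasurableSet Δ) :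
    ∀ᵐ ξ ∂μ, ∀ Λ, MeasurableSet[⨅ n, B n] Λ →
      condExpKernel μ (⨅ n, B n) ξ (Δ ∩ Λ) =
        condExpKernel μ (⨅ n, B n) ξ Δ * condExpKernel μ (⨅ n, B n) ξ Λ := by
  have hC : ⨅ n, B n ≤ mΩ := (iInf_le B 0).trans (hle 0)
  let h : ℕ → Ω → ℝ := fun n η => (condExpKernel μ (B n) η).real Δ
  let g : Ω → ℝ := fun ξ => (condExpKernel μ (⨅ n, B n) ξ).real Δ
  have hh : ∀ n, Measurable (h n) := fun n =>
    ((measurable_condExpKernel hΔ).mono (hle n) le_rfl).ennreal_toReal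
  have hg : Measurable[⨅ n, B n] g := (measurable_condExpKernel hΔ).ennreal_toReal
  let F : ℕ → Ω × Ω → ENNReal := fun n z => ‖h n z.2 - g z.1‖ₑ
  have hF : ∀ n, Measurable[(⨅ n, B n).prod mΩ] (F n) := fun n => by
    have h1 : Measurable[(⨅ n, B n).prod mΩ] fun z : Ω × Ω => h n z.2 :=
      (hh n).comp measurable_snd
    have h2 : Measurable[(⨅ n, B n).prod mΩ] fun z : Ω × Ω => g z.1 :=
      Measurable.comp (g := g) hg measurable_fst
    exact measurable_enorm.comp (Measurable.sub h1 h2)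
  -- The mean distance, under the conditional measure at `ξ`, between the conditional probability
  -- given `B n` and the constant `g ξ`. Its `μ`-integral is the `L¹` distance along the diagonal,
  -- which tends to zero.
  let J : ℕ → Ω → ENNReal := fun n ξ => ∫⁻ η, F n (ξ, η) ∂condExpKernel μ (⨅ n, B n) ξ
  have hJ : ∀ n, Measurable (J n) := fun n =>
    (Measurable.lintegral_kernel_prod_right' (hF n)).mono hC le_rfl
  have hJint : Tendsto (fun n => ∫⁻ ξ, J n ξ ∂μ) atTop (𝓝 0) := by
    have hmem : MemLp (Δ.indicator fun _ => (1 : ℝ)) 2 μ :=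
      memLp_indicator_const 2 hΔ 1 (Or.inr (measure_ne_top _ _))
    refine (tendsto_eLpNorm_condExp_iInf hB hle hmem).congr fun n => ?_
    rw [lintegral_lintegral_condExpKernel hC (hF n), eLpNorm_one_eq_lintegral_enorm]
    refine lintegral_congr_ae ?_
    filter_upwards [condExpKernel_ae_eq_condExp (μ := μ) (hle n) hΔ,
      condExpKernel_ae_eq_condExp (μ := μ) hC hΔ] with ξ h1 h2
    simp only [F, h, g, Pi.sub_apply, h1, h2]
  -- Fatou's lemma; the liminf suffices because the quantity bounded by `J n ξ` below does not
  -- depend on `n`.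
  have hlim : ∀ᵐ ξ ∂μ, liminf (fun n => J n ξ) atTop = 0 := by
    have h1 : ∫⁻ ξ, liminf (fun n => J n ξ) atTop ∂μ = 0 := by
      refine le_antisymm ((lintegral_liminf_le hJ).trans ?_) zero_le
      rw [hJint.liminf_eq]
    exact (lintegral_eq_zero_iff (Measurable.liminf hJ)).1 h1
  have hinter : ∀ᵐ ξ ∂μ, ∀ n, ∀ Λ, MeasurableSet[B n] Λ →
      condExpKernel μ (⨅ n, B n) ξ (Δ ∩ Λ) =
        ∫⁻ η in Λ, condExpKernel μ (B n) η Δ ∂condExpKernel μ (⨅ n, B n) ξ :=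
    ae_all_iff.2 fun n => ae_condExpKernel_inter_eq (iInf_le B n) (hle n) (hcg n) hΔ
  filter_upwards [hlim, hinter] with ξ hξ1 hξ2 Λ hΛ
  let ν := condExpKernel μ (⨅ n, B n) ξ
  have hbound : ∀ n, ‖ν.real (Δ ∩ Λ) - ν.real Δ * ν.real Λ‖ₑ ≤ J n ξ := by
    intro n
    have e1 : ν.real (Δ ∩ Λ) = ∫ η in Λ, h n η ∂ν := by
      rw [measureReal_def, hξ2 n Λ (iInf_le B n _ hΛ)]
      refine (integral_toReal ?_ ?_).symm
      · exact ((measurable_condExpKernel hΔ).mono (hle n) le_rfl).aemeasurable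
      · exact ae_of_all _ fun η => measure_lt_top _ _
    have hi : Integrable (h n) (ν.restrict Λ) := by
      refine Integrable.of_bound (hh n).aestronglyMeasurable 1 (ae_of_all _ fun η => ?_)
      rw [Real.norm_of_nonneg measureReal_nonneg]
      exact measureReal_le_one
    have e2 : ν.real (Δ ∩ Λ) - ν.real Δ * ν.real Λ = ∫ η in Λ, (h n η - g ξ) ∂ν := by
      rw [integral_sub hi (integrable_const _), ← e1, setIntegral_const, smul_eq_mul, mul_comm]
    rw [e2]
    exact (enorm_integral_le_lintegral_enorm _).trans (setLIntegral_le_lintegral _ _)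
  have h0 : ‖ν.real (Δ ∩ Λ) - ν.real Δ * ν.real Λ‖ₑ ≤ 0 := by
    rw [← hξ1]
    exact le_liminf_of_le (by isBoundedDefault) (Eventually.of_forall hbound)
  have h1 : ν.real (Δ ∩ Λ) = ν.real Δ * ν.real Λ := by
    rw [nonpos_iff_eq_zero, enorm_eq_zero, sub_eq_zero] at h0
    exact h0
  have h2 : (ν (Δ ∩ Λ)).toReal = (ν Δ * ν Λ).toReal := by
    rw [ENNReal.toReal_mul]
    exact h1
  exact (ENNReal.toReal_eq_toReal_iff' (measure_ne_top _ _)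
    (ENNReal.mul_ne_top (measure_ne_top _ _) (measure_ne_top _ _))).1 h2

/-- The conditional measures with respect to the intersection of a decreasing sequence of countably
generated σ-algebras are trivial on this intersection. -/
lemma ae_condExpKernel_iInf_eq_zero_or_one (hB : Antitone B) (hle : ∀ n, B n ≤ mΩ)
    (hcg : ∀ n, @MeasurableSpace.CountablyGenerated Ω (B n)) :
    ∀ᵐ ξ ∂μ, ∀ Λ, MeasurableSet[⨅ n, B n] Λ →
      condExpKernel μ (⨅ n, B n) ξ Λ = 0 ∨ condExpKernel μ (⨅ n, B n) ξ Λ = 1 := by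
  have hC : ⨅ n, B n ≤ mΩ := (iInf_le B 0).trans (hle 0)
  obtain ⟨D, hDc, hDπ, hD⟩ := exists_countable_isPiSystem mΩ inferInstance
  have hDm : ∀ Δ ∈ D, MeasurableSet Δ := fun Δ h => by
    rw [hD]; exact MeasurableSpace.measurableSet_generateFrom h
  have key := (ae_ball_iff (μ := μ) hDc).2 fun Δ hΔ =>
    ae_condExpKernel_iInf_inter_eq_mul (μ := μ) hB hle hcg (hDm Δ hΔ)
  filter_upwards [key] with ξ hξ Λ hΛ
  let ν := condExpKernel μ (⨅ n, B n) ξ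
  -- Independence extends from the π-system to all events; evaluation at `Λ` itself makes `ν Λ`
  -- idempotent.
  have hν : ν.restrict Λ = ν Λ • ν := by
    refine ext_of_generate_finite D hD hDπ (fun Δ hΔ => ?_) ?_
    · rw [Measure.restrict_apply (hDm Δ hΔ), hξ Δ hΔ Λ hΛ, Measure.smul_apply, smul_eq_mul,
        mul_comm]
    · simp [ν]
  have h1 : ν Λ = ν Λ * ν Λ := by
    have := congrArg (fun ρ : Measure Ω => ρ Λ) hν
    simpa using this
  have h2 : ν Λ ≠ ⊤ := measure_ne_top _ _
  rcases eq_or_ne (ν Λ) 0 with h0 | h0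
  · exact Or.inl h0
  · right
    have : ν Λ * 1 = ν Λ * ν Λ := by rwa [mul_one]
    exact ((ENNReal.mul_right_inj h0 h2).1 this).symm

/-- Ergodic decomposition with respect to the intersection of a decreasing sequence of countably
generated σ-algebras: the conditional measures can be chosen so that all of them are trivial on the
intersection, and each is concentrated on the set of the points to which it belongs. -/
theorem exists_ergodic_disintegration (μ : Measure Ω) [IsProbabilityMeasure μ] (hB : Antitone B)
    (hle : ∀ n, B n ≤ mΩ) (hcg : ∀ n, @MeasurableSpace.CountablyGenerated Ω (B n)) :
    ∃ q : Ω → Measure Ω, Measurable[⨅ n, B n] q ∧ (∀ ξ, IsProbabilityMeasure (q ξ)) ∧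
      (∀ ξ Λ, MeasurableSet[⨅ n, B n] Λ → q ξ Λ = 0 ∨ q ξ Λ = 1) ∧
      (∀ ξ, ∀ᵐ η ∂q ξ, q η = q ξ) ∧
      (∀ Δ Λ, MeasurableSet Δ → MeasurableSet[⨅ n, B n] Λ →
        ∫⁻ ξ in Λ, q ξ Δ ∂μ = μ (Δ ∩ Λ)) := by
  have hC : ⨅ n, B n ≤ mΩ := (iInf_le B 0).trans (hle 0)
  let K : Ω → Measure Ω := fun ξ => condExpKernel μ (⨅ n, B n) ξ
  have hK : Measurable[⨅ n, B n] K := (condExpKernel μ (⨅ n, B n)).measurable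
  have hKp : ∀ ξ, IsProbabilityMeasure (K ξ) := fun ξ => by simp only [K]; infer_instance
  have hae := ae_condExpKernel_iInf_eq_zero_or_one (μ := μ) hB hle hcg
  obtain ⟨T, hTsub, hTm, hT⟩ := exists_measurable_superset_of_null (ae_iff.1 hae)
  have hTgood : ∀ η, η ∉ T → ∀ Λ, MeasurableSet[⨅ n, B n] Λ → K η Λ = 0 ∨ K η Λ = 1 := by
    intro η hη
    by_contra hcon
    exact hη (hTsub hcon)
  have hEq := measurableSet_condExpKernel_eq (μ := μ) hC
  let G : Set Ω := {ξ | K ξ T = 0 ∧ K ξ {η | K η = K ξ}ᶜ = 0}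
  have hsec : ∀ ξ, MeasurableSet {η | K η = K ξ} := fun ξ =>
    @measurable_prodMk_left _ _ (⨅ n, B n) mΩ ξ _ hEq
  have hGm : MeasurableSet[⨅ n, B n] G := by
    refine MeasurableSet.inter ?_ ?_
    · exact measurable_condExpKernel hTm (measurableSet_singleton 0)
    · have : Measurable[⨅ n, B n] fun ξ => condExpKernel μ (⨅ n, B n) ξ
          (Prod.mk ξ ⁻¹' {z : Ω × Ω | K z.2 = K z.1}ᶜ) :=
        Kernel.measurable_kernel_prodMk_left hEq.compl
      exact this (measurableSet_singleton 0)
  have hGae : ∀ᵐ ξ ∂μ, ξ ∈ G := by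
    have h1 : ∀ᵐ ξ ∂μ, ∀ᵐ η ∂K ξ, η ∉ T :=
      ae_condExpKernel_of_ae hC (p := fun z => z.2 ∉ T)
        (@measurable_snd _ _ (⨅ n, B n) mΩ _ hTm.compl) (measure_eq_zero_iff_ae_notMem.1 hT)
    filter_upwards [h1, ae_ae_condExpKernel_eq (μ := μ) hC] with ξ h2 h3
    exact ⟨measure_eq_zero_iff_ae_notMem.2 h2, h3⟩
  obtain ⟨ξ₀, hξ₀⟩ := hGae.exists
  classical
  -- The default value is itself a good component, so no new measure enters.
  let q : Ω → Measure Ω := fun ξ => if ξ ∈ G then K ξ else K ξ₀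
  have hq : ∀ ξ, ∃ ζ ∈ G, q ξ = K ζ := fun ξ => by
    by_cases h : ξ ∈ G
    · exact ⟨ξ, h, if_pos h⟩
    · exact ⟨ξ₀, hξ₀, if_neg h⟩
  have htriv : ∀ ζ ∈ G, ∀ Λ, MeasurableSet[⨅ n, B n] Λ → K ζ Λ = 0 ∨ K ζ Λ = 1 := by
    intro ζ hζ
    -- Even if `ζ` lies in `T`, its measure is shared by some point outside `T`.
    have h1 : ∀ᵐ η ∂K ζ, η ∉ T ∧ K η = K ζ :=
      (measure_eq_zero_iff_ae_notMem.1 hζ.1).and hζ.2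
    obtain ⟨η, hη, he⟩ := h1.exists
    rw [← he]
    exact hTgood η hη
  refine ⟨q, Measurable.ite hGm hK measurable_const, fun ξ => ?_, fun ξ => ?_, fun ξ => ?_,
    fun Δ Λ hΔ hΛ => ?_⟩
  · obtain ⟨ζ, -, h⟩ := hq ξ
    rw [h]; infer_instance
  · obtain ⟨ζ, hζ, h⟩ := hq ξ
    rw [h]; exact htriv ζ hζ
  · obtain ⟨ζ, hζ, h⟩ := hq ξ
    rw [h]
    have h1 : ∀ᵐ η ∂K ζ, K η = K ζ := hζ.2
    filter_upwards [h1] with η hη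
    have hηG : η ∈ G := by
      simpa only [G, Set.mem_ofPred_eq, hη] using hζ
    rw [← hη]
    exact if_pos hηG
  · have h1 : ∫⁻ ξ in Λ, q ξ Δ ∂μ = ∫⁻ ξ in Λ, K ξ Δ ∂μ := by
      refine lintegral_congr_ae (ae_restrict_of_ae ?_)
      filter_upwards [hGae] with ξ hξ
      simp only [q, if_pos hξ]
    have h2 := setLIntegral_lintegral_condExpKernel (μ := μ) hC (measurable_one.indicator hΔ) hΛ
    simp only [lintegral_indicator_one hΔ] at h2
    rw [h1, h2, Measure.restrict_apply hΔ]

end ErgodicDecomposition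

/-! ### Domination of all normal states by one measure -/

section Domination

/-- Weak convergence to zero of contractions may be checked on the diagonal, for a dense sequence of
unit vectors. -/
lemma tendsto_inner_apply_zero {H : Type*} [NormedAddCommGroup H] [InnerProductSpace ℂ H]
    {Q : ℕ → H →L[ℂ] H} (hQ : ∀ n, ‖Q n‖ ≤ 1)
    {e : ℕ → Metric.sphere (0 : H) 1} (he : DenseRange e)
    (h : ∀ k, Tendsto (fun n => inner ℂ (e k : H) (Q n (e k))) atTop (𝓝 0)) (x y : H) :
    Tendsto (fun n => inner ℂ y (Q n x)) atTop (𝓝 0) := by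
  have hunit : ∀ x : Metric.sphere (0 : H) 1,
      Tendsto (fun n => inner ℂ (x : H) (Q n x)) atTop (𝓝 0) := by
    intro x
    rw [Metric.tendsto_atTop]
    intro ε hε
    -- Replacing `x` by `e k` in both entries costs at most `2 * ‖x - e k‖`; the other `ε / 2` is
    -- left for the diagonal term.
    obtain ⟨k, hk⟩ := he.exists_dist_lt x (ε := ε / 4) (by positivity)
    obtain ⟨n₀, hn₀⟩ := Metric.tendsto_atTop.1 (h k) (ε / 2) (by positivity)
    refine ⟨n₀, fun n hn => ?_⟩
    have h1 := hn₀ n hn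
    rw [dist_zero_right] at h1 ⊢
    rw [Subtype.dist_eq, dist_eq_norm] at hk
    have hx1 : ‖(x : H)‖ = 1 := by simp
    have he1 : ‖(e k : H)‖ = 1 := by simp
    have hQle : ∀ z, ‖Q n z‖ ≤ ‖z‖ := fun z => by
      simpa using (Q n).le_of_opNorm_le (hQ n) z
    have h2 : inner ℂ (x : H) (Q n x) = inner ℂ ((x : H) - e k) (Q n x) +
        inner ℂ (e k : H) (Q n ((x : H) - e k)) + inner ℂ (e k : H) (Q n (e k)) := by
      simp only [map_sub, inner_sub_left, inner_sub_right]
      ring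
    have h3 : ‖inner ℂ ((x : H) - e k) (Q n x)‖ ≤ ‖(x : H) - e k‖ := by
      refine (norm_inner_le_norm _ _).trans ?_
      have := hQle x
      rw [hx1] at this
      exact mul_le_of_le_one_right (norm_nonneg _) this
    have h4 : ‖inner ℂ (e k : H) (Q n ((x : H) - e k))‖ ≤ ‖(x : H) - e k‖ := by
      refine (norm_inner_le_norm _ _).trans ?_
      rw [he1, one_mul]
      exact hQle _
    rw [h2]
    refine (norm_add₃_le).trans_lt ?_
    linarith
  have hdiag : ∀ x : H, Tendsto (fun n => inner ℂ (Q n x) x) atTop (𝓝 0) := by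
    intro x
    rcases eq_or_ne x 0 with rfl | hx0
    · simp
    have hn : (‖x‖ : ℂ) ≠ 0 := by simpa using hx0
    have h1 := hunit ⟨((‖x‖ : ℂ)⁻¹) • x, by simp [norm_smul, norm_ne_zero_iff.2 hx0]⟩
    have h2 := ((h1.const_mul ((‖x‖ : ℂ) ^ 2)).star)
    simp only [mul_zero, star_zero] at h2
    refine h2.congr fun n => ?_
    rw [map_smul, inner_smul_left, inner_smul_right, map_inv₀, Complex.conj_ofReal]
    rw [← inner_conj_symm (Q n x) x, Complex.star_def]
    congr 1
    field_simp
  have hpol : ∀ n, inner ℂ (Q n x) y = _ := fun n => inner_map_polarization' (Q n).toLinearMap x y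
  have h1 : Tendsto (fun n => inner ℂ (Q n x) y) atTop (𝓝 0) := by
    simp_rw [hpol]
    have := ((((hdiag (x + y)).sub (hdiag (x - y))).sub
      ((hdiag (x + Complex.I • y)).const_mul Complex.I)).add
      ((hdiag (x - Complex.I • y)).const_mul Complex.I)).div_const 4
    simp only [sub_zero, mul_zero, add_zero, zero_div] at this
    exact this
  have h2 := h1.star
  rw [star_zero] at h2
  exact h2.congr fun n => inner_conj_symm _ _

variable {H : Type*} [NormedAddCommGroup H] [InnerProductSpace ℂ H] [CompleteSpace H]

open scoped ComplexOrder in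
/-- The normal state determined by a unit vector. -/
noncomputable def vectorState (A : StarSubalgebra ℂ (H →L[ℂ] H)) (x : Metric.sphere (0 : H) 1) :
    NormalState A where
  toLinearMap :=
    { toFun := fun T => inner ℂ (x : H) ((T : H →WOT[ℂ] H) x)
      map_add' := fun T T' => by simp
      map_smul' := fun c T => by simp }
  nonneg := fun T hT => by
    have h1 : (0 : ℂ) ≤ inner ℂ (x : H) ((T : H →WOT[ℂ] H) x) := hT.inner_nonneg_right x
    exact ⟨(Complex.nonneg_iff.1 h1).1, (Complex.nonneg_iff.1 h1).2.symm⟩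
  map_one := by
    have : ‖(x : H)‖ = 1 := by simp
    simp [inner_self_eq_norm_sq_to_K, this]
  normal := fun r => by
    refine Continuous.continuousOn ?_
    change Continuous fun T : weakClosure A => inner ℂ (x : H) ((T : H →WOT[ℂ] H) x)
    exact ContinuousLinearMapWOT.continuous_inner_apply continuous_subtype_val _ _

lemma vectorState_apply (A : StarSubalgebra ℂ (H →L[ℂ] H)) (x : Metric.sphere (0 : H) 1)
    (T : weakClosure A) :
    (vectorState A x).toLinearMap T = inner ℂ (x : H) ((T : H →WOT[ℂ] H) x) := rfl

namespace MonitoredSystem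

variable {X : Type*} [Fintype X] [MeasurableSpace X] [DiscreteMeasurableSpace X]
  (S : MonitoredSystem H X)

/-- Events that depend on finitely many outcomes are represented by effects. -/
lemma exists_effect_of_mem_measurableCylinders {C : Set (ℕ → X)}
    (hC : C ∈ measurableCylinders fun _ : ℕ => X) :
    ∃ Q : weakClosure S.observables, (Q : H →WOT[ℂ] H).toCLM.IsPositive ∧
      ∀ ω : NormalState S.observables,
        S.historyMeasure ω C = ENNReal.ofReal (ω.toLinearMap Q).re := by
  classical
  rcases isEmpty_or_nonempty X with hX | ⟨⟨x₀⟩⟩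
  · refine ⟨0, by simp, fun ω => ?_⟩
    have : IsEmpty (ℕ → X) := ⟨fun f => hX.false (f 0)⟩
    simp [Set.eq_empty_of_isEmpty C]
  obtain ⟨s, S₀, -, rfl⟩ := (mem_measurableCylinders _).1 hC
  obtain ⟨n, hn⟩ := s.exists_nat_subset_range
  -- The event depends on the first `n` outcomes only; `x₀` is mere padding.
  let ex : (Fin n → X) → (ℕ → X) := fun v i => if h : i < n then v ⟨i, h⟩ else x₀
  let V : Finset (Fin n → X) := Finset.univ.filter fun v => ex v ∈ MeasureTheory.cylinder s S₀
  have hmem : ∀ ξ η : ℕ → X, (∀ i < n, ξ i = η i) → ξ ∈ MeasureTheory.cylinder s S₀ →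
      η ∈ MeasureTheory.cylinder s S₀ := by
    intro ξ η h hξ
    rw [mem_cylinder] at hξ ⊢
    have : s.restrict η = s.restrict ξ := by
      funext i
      exact (h i (Finset.mem_range.1 (hn i.2))).symm
    rwa [this]
  have hexv : ∀ v (i : Fin n), ex v i = v i := fun v i => by simp [ex]
  have hU : MeasureTheory.cylinder s S₀ = ⋃ v ∈ V, cylinder (ex v) n := by
    ext η
    simp only [Set.mem_iUnion, exists_prop, V, Finset.mem_filter, Finset.mem_univ, true_and]
    constructor
    · intro h
      have h1 : ∀ i < n, η i = ex (fun i : Fin n => η i) i := fun i hi => by simp [ex, hi]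
      exact ⟨fun i => η i, hmem _ _ h1 h, h1⟩
    · rintro ⟨v, hv, h⟩
      exact hmem _ _ (fun i hi => (h i hi).symm) hv
  have hpos : ∀ v, ((S.historyEffect (ex v) n : weakClosure S.observables) :
      H →WOT[ℂ] H).toCLM.IsPositive := fun v =>
    ContinuousLinearMap.isPositive_self_comp_adjoint (S.stretch (ex v) 0 n)
  refine ⟨∑ v ∈ V, S.historyEffect (ex v) n, ?_, fun ω => ?_⟩
  · rw [Submodule.coe_sum]
    change ((ContinuousLinearMapWOT.linearEquiv ℂ) (∑ v ∈ V, _)).IsPositive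
    rw [map_sum, ← ContinuousLinearMap.nonneg_iff_isPositive]
    exact Finset.sum_nonneg fun v _ => (ContinuousLinearMap.nonneg_iff_isPositive _).2 (hpos v)
  · rw [hU, measure_biUnion_finset]
    · simp_rw [historyMeasure_cylinder]
      rw [← ENNReal.ofReal_sum_of_nonneg fun v _ => (ω.nonneg _ (hpos v)).1, map_sum,
        Complex.re_sum]
    · intro v _ w _ hvw
      refine Set.disjoint_left.2 fun η h1 h2 => hvw ?_
      funext i
      rw [← hexv v i, ← hexv w i, ← h1 i i.2, ← h2 i i.2]
    · exact fun v _ => measurableSet_cylinder _ _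

/-- The norm of an effect is at most one. -/
lemma norm_le_one_of_effect {C : Set (ℕ → X)} {Q : weakClosure S.observables}
    (hQ : (Q : H →WOT[ℂ] H).toCLM.IsPositive)
    (h : ∀ ω : NormalState S.observables,
        S.historyMeasure ω C = ENNReal.ofReal (ω.toLinearMap Q).re) :
    ‖(Q : H →WOT[ℂ] H).toCLM‖ ≤ 1 := by
  have h1 : ∀ x : Metric.sphere (0 : H) 1, (inner ℂ (x : H) ((Q : H →WOT[ℂ] H) x)).re ≤ 1 := by
    intro x
    have := h (vectorState S.observables x)
    rw [← ENNReal.ofReal_le_one, ← vectorState_apply, ← this]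
    exact prob_le_one
  rw [CStarAlgebra.norm_le_one_iff_of_nonneg _ ((ContinuousLinearMap.nonneg_iff_isPositive _).2 hQ),
    ContinuousLinearMap.le_def, ContinuousLinearMap.isPositive_def]
  refine ⟨(ContinuousLinearMap.isPositive_one.isSymmetric).sub hQ.isSymmetric, fun x => ?_⟩
  have hx : (inner ℂ ((Q : H →WOT[ℂ] H) x) x).re ≤ ‖x‖ ^ 2 := by
    rcases eq_or_ne x 0 with rfl | hx0
    · simp
    have hn : ‖x‖ ≠ 0 := norm_ne_zero_iff.2 hx0
    have h2 := h1 ⟨((‖x‖ : ℂ)⁻¹) • x, by simp [norm_smul, hn]⟩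
    have h3 : (inner ℂ (((‖x‖ : ℂ)⁻¹) • x)
        ((Q : H →WOT[ℂ] H) (((‖x‖ : ℂ)⁻¹) • x))).re =
        (‖x‖ ^ 2)⁻¹ * (inner ℂ ((Q : H →WOT[ℂ] H) x) x).re := by
      rw [map_smul, inner_smul_left, inner_smul_right, ← mul_assoc, ← inner_conj_symm,
        map_inv₀, Complex.conj_ofReal, ← mul_inv, ← Complex.ofReal_mul, ← Complex.ofReal_inv,
        Complex.re_ofReal_mul, Complex.conj_re, sq]
    rw [h3, inv_mul_le_iff₀ (by positivity), mul_one] at h2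
    exact h2
  have h4 : (inner ℂ x x).re = ‖x‖ ^ 2 := by
    rw [inner_self_eq_norm_sq_to_K]
    norm_cast
  change 0 ≤ (inner ℂ (x - (Q : H →WOT[ℂ] H) x) x).re
  rw [inner_sub_left, Complex.sub_re, h4]
  linarith

/-- If an event has probability zero in all members of a dense sequence of vector states, then it
has probability zero in every normal state. -/
lemma historyMeasure_eq_zero_of_vectorState {e : ℕ → Metric.sphere (0 : H) 1} (he : DenseRange e)
    {Δ : Set (ℕ → X)} (hΔ : MeasurableSet Δ)
    (h : ∀ k, S.historyMeasure (vectorState S.observables (e k)) Δ = 0)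
    (ω : NormalState S.observables) : S.historyMeasure ω Δ = 0 := by
  let μ : ℕ → Measure (ℕ → X) := fun k => S.historyMeasure (vectorState S.observables (e k))
  -- One event `C n` must approximate `Δ` simultaneously for `ω` and for the first `n` vector
  -- states.
  let ρ : ℕ → Measure (ℕ → X) := fun n => S.historyMeasure ω + ∑ k ∈ Finset.range n, μ k
  have hring : IsSetRing (measurableCylinders fun _ : ℕ => X) :=
    { empty_mem := empty_mem_measurableCylinders _
      union_mem := fun _ _ => union_mem_measurableCylinders
      sdiff_mem := fun _ _ => sdiff_mem_measurableCylinders }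
  have happ : ∀ n : ℕ, ∃ C ∈ measurableCylinders (fun _ : ℕ => X),
      ρ n (symmDiff C Δ) < ((n : ENNReal) + 1)⁻¹ := fun n => by
    refine exists_measure_symmDiff_lt_of_generateFrom_isSetRing hring
      ⟨{Set.univ}, Set.countable_singleton _, ?_, by simp⟩
      generateFrom_measurableCylinders.symm hΔ (by simp)
    simpa using univ_mem_measurableCylinders fun _ : ℕ => X
  choose C hC hlt using happ
  choose Q hQpos hQ using fun n => S.exists_effect_of_mem_measurableCylinders (hC n)
  have hinv : Tendsto (fun n : ℕ => ((n : ENNReal) + 1)⁻¹) atTop (𝓝 0) := by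
    have := (tendsto_add_atTop_iff_nat 1).2 ENNReal.tendsto_inv_nat_nhds_zero
    simpa using this
  have hlim : ∀ k, Tendsto (fun n => μ k (C n)) atTop (𝓝 0) := by
    intro k
    refine tendsto_of_tendsto_of_tendsto_of_le_of_le' tendsto_const_nhds hinv
      (Eventually.of_forall fun _ => zero_le) ?_
    filter_upwards [eventually_gt_atTop k] with n hn
    have h1 : μ k (C n) ≤ μ k (symmDiff (C n) Δ) := by
      calc μ k (C n) ≤ μ k (symmDiff (C n) Δ ∪ Δ) := measure_mono fun ξ hξ => by
            by_cases hξΔ : ξ ∈ Δ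
            · exact Or.inr hξΔ
            · exact Or.inl (Or.inl ⟨hξ, hξΔ⟩)
        _ ≤ μ k (symmDiff (C n) Δ) + μ k Δ := measure_union_le _ _
        _ = μ k (symmDiff (C n) Δ) := by rw [show μ k Δ = 0 from h k, add_zero]
    have h2 : μ k ≤ ρ n := by
      refine le_trans ?_ (Measure.le_add_left le_rfl)
      exact Finset.single_le_sum (f := μ) (fun _ _ => Measure.zero_le _) (Finset.mem_range.2 hn)
    exact h1.trans ((h2 _).trans (hlt n).le)
  have hnorm : ∀ n, ‖(Q n : H →WOT[ℂ] H).toCLM‖ ≤ 1 := fun n =>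
    S.norm_le_one_of_effect (hQpos n) (hQ n)
  have hinner : ∀ k, Tendsto (fun n => inner ℂ (e k : H) ((Q n : H →WOT[ℂ] H).toCLM (e k)))
      atTop (𝓝 0) := by
    intro k
    have h1 := (ENNReal.tendsto_toReal ENNReal.zero_ne_top).comp (hlim k)
    have h2 : Tendsto (fun n => (((μ k (C n)).toReal : ℝ) : ℂ)) atTop (𝓝 0) := by
      exact_mod_cast (Complex.continuous_ofReal.tendsto 0).comp h1
    refine h2.congr fun n => ?_
    obtain ⟨h3, h4⟩ := (vectorState S.observables (e k)).nonneg (Q n) (hQpos n)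
    rw [show μ k (C n) = _ from hQ n _, ENNReal.toReal_ofReal h3]
    exact Complex.ext rfl h4.symm
  have hWOT : Tendsto Q atTop (𝓝 0) := by
    rw [tendsto_subtype_rng, ContinuousLinearMapWOT.tendsto_iff_forall_inner_apply_tendsto]
    intro x y
    simpa using tendsto_inner_apply_zero hnorm he hinner x y
  have hω : Tendsto (fun n => ω.toLinearMap (Q n)) atTop (𝓝 0) := by
    have h1 := ω.normal 1 0 (by simp)
    rw [ContinuousWithinAt, map_zero] at h1
    exact h1.comp (tendsto_nhdsWithin_iff.2 ⟨hWOT, Eventually.of_forall hnorm⟩)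
  have hωC : Tendsto (fun n => S.historyMeasure ω (C n)) atTop (𝓝 0) := by
    simp_rw [hQ _ ω]
    have h1 := (Complex.continuous_re.tendsto 0).comp hω
    have h2 := ENNReal.tendsto_ofReal h1
    simpa using h2
  have hle : ∀ n, S.historyMeasure ω Δ ≤ S.historyMeasure ω (C n) + ((n : ENNReal) + 1)⁻¹ := by
    intro n
    calc S.historyMeasure ω Δ ≤ S.historyMeasure ω (C n ∪ symmDiff (C n) Δ) :=
          measure_mono fun ξ hξ => by
            by_cases hξC : ξ ∈ C n
            · exact Or.inl hξC
            · exact Or.inr (Or.inr ⟨hξ, hξC⟩)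
      _ ≤ S.historyMeasure ω (C n) + S.historyMeasure ω (symmDiff (C n) Δ) :=
          measure_union_le _ _
      _ ≤ S.historyMeasure ω (C n) + ((n : ENNReal) + 1)⁻¹ := by
          gcongr
          exact le_trans ((Measure.le_add_right le_rfl : S.historyMeasure ω ≤ ρ n) _) (hlt n).le
  refine le_antisymm ?_ zero_le
  have := hωC.add hinv
  rw [add_zero] at this
  exact ge_of_tendsto' this hle

/-- The measures on histories that belong to normal states are dominated by a single one. -/
lemma exists_dominating_measure [TopologicalSpace.SeparableSpace H]
    (h : Nonempty (NormalState S.observables)) :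
    ∃ μ : Measure (ℕ → X), IsProbabilityMeasure μ ∧
      ∀ ω : NormalState S.observables, S.historyMeasure ω ≪ μ := by
  obtain ⟨ω₀⟩ := h
  -- A state takes the value `1` at the identity, which excludes `H = 0`.
  have hne : Nonempty (Metric.sphere (0 : H) 1) := by
    have : Nontrivial H := by
      by_contra hcon
      rw [not_nontrivial_iff_subsingleton] at hcon
      have h1 := ω₀.map_one
      have h2 : (⟨ContinuousLinearMapWOT.ofCLM 1, ofCLM_mem_weakClosure (one_mem S.observables)⟩ :
          weakClosure S.observables) = 0 := by
        exact Subtype.ext (ContinuousLinearMapWOT.ext fun x => Subsingleton.elim _ _)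
      rw [h2, map_zero] at h1
      exact zero_ne_one h1
    obtain ⟨x, hx⟩ := exists_norm_eq H (zero_le_one' ℝ)
    exact ⟨⟨x, by simpa using hx⟩⟩
  have : SecondCountableTopology H := UniformSpace.secondCountable_of_separable H
  let e := TopologicalSpace.denseSeq (Metric.sphere (0 : H) 1)
  have he : DenseRange e := TopologicalSpace.denseRange_denseSeq _
  let μ : ℕ → Measure (ℕ → X) := fun k => S.historyMeasure (vectorState S.observables (e k))
  have hnz : NeZero (Measure.sum μ) := by
    refine ⟨fun h0 => ?_⟩
    have h1 : μ 0 Set.univ ≤ Measure.sum μ Set.univ := Measure.le_sum μ 0 _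
    rw [h0] at h1
    simp [μ] at h1
  -- A probability measure with the same null sets as the countable sum.
  refine ⟨(Measure.sum μ).toFinite, inferInstance, fun ω => ?_⟩
  refine Measure.AbsolutelyContinuous.mk fun Δ hΔ h0 => ?_
  rw [toFinite_apply_eq_zero_iff, Measure.sum_apply_eq_zero] at h0
  exact S.historyMeasure_eq_zero_of_vectorState he hΔ h0 ω

end MonitoredSystem
end Domination

/-! ### Sufficient statistics and reweighted components -/

section Components

variable {Ω : Type*} {C : MeasurableSpace Ω} [mΩ : MeasurableSpace Ω] {μ : Measure Ω}

/-- A function that is measurable with respect to `C` may be taken out of the integrals against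
the components of a disintegration over `C`. -/
lemma lintegral_mul_lintegral_disintegration [IsFiniteMeasure μ] (hC : C ≤ mΩ) {q : Ω → Measure Ω}
    (hq : Measurable[C] q)
    (hdis : ∀ Δ Λ, MeasurableSet Δ → MeasurableSet[C] Λ → ∫⁻ ξ in Λ, q ξ Δ ∂μ = μ (Δ ∩ Λ))
    {c F : Ω → ENNReal} (hc : Measurable[C] c) (hF : Measurable F) :
    ∫⁻ ξ, c ξ * ∫⁻ η, F η ∂q ξ ∂μ = ∫⁻ ξ, c ξ * F ξ ∂μ := by
  have hqm : Measurable q := hq.mono hC le_rfl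
  have hbind : ∀ Λ, MeasurableSet[C] Λ → (μ.restrict Λ).bind q = μ.restrict Λ := by
    intro Λ hΛ
    ext Δ hΔ
    rw [Measure.bind_apply hΔ hqm.aemeasurable, hdis Δ Λ hΔ hΛ, Measure.restrict_apply hΔ]
  have hset : ∀ Λ, MeasurableSet[C] Λ →
      ∫⁻ ξ in Λ, ∫⁻ η, F η ∂q ξ ∂μ = ∫⁻ ξ in Λ, F ξ ∂μ := by
    intro Λ hΛ
    rw [← Measure.lintegral_bind hqm.aemeasurable hF.aemeasurable, hbind Λ hΛ]
  have hFq : Measurable fun ξ => ∫⁻ η, F η ∂q ξ := (Measure.measurable_lintegral hF).comp hqm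
  -- The measures with densities `F` and its average over `q ξ` coincide on `C`, so they integrate
  -- the `C`-measurable `c` alike.
  have htrim : (μ.withDensity fun ξ => ∫⁻ η, F η ∂q ξ).trim hC = (μ.withDensity F).trim hC := by
    refine @Measure.ext _ C _ _ fun Λ hΛ => ?_
    rw [trim_measurableSet_eq hC hΛ, trim_measurableSet_eq hC hΛ,
      withDensity_apply _ (hC _ hΛ), withDensity_apply _ (hC _ hΛ), hset Λ hΛ]
  have hcm : Measurable c := hc.mono hC le_rfl
  have h1 := lintegral_trim (μ := μ.withDensity fun ξ => ∫⁻ η, F η ∂q ξ) hC hc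
  have h2 := lintegral_trim (μ := μ.withDensity F) hC hc
  rw [htrim, h2, lintegral_withDensity_eq_lintegral_mul _ hFq hcm,
    lintegral_withDensity_eq_lintegral_mul _ hF hcm] at h1
  simp only [Pi.mul_apply] at h1
  simp_rw [mul_comm (c _)]
  exact h1.symm

/-- A dominated family of measures has a sufficient statistic with values in the space of real
sequences. -/
lemma exists_sufficient_statistic [MeasurableSpace.CountablyGenerated Ω] [IsProbabilityMeasure μ]
    {I : Type*} [Nonempty I] (ρ : I → Measure Ω) [∀ i, IsProbabilityMeasure (ρ i)]
    (hρ : ∀ i, ρ i ≪ μ) :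
    ∃ g : Ω → ℕ → ℝ, Measurable g ∧ ∀ i, ∃ f : Ω → ENNReal,
      Measurable[MeasurableSpace.comap g inferInstance] f ∧ ρ i = μ.withDensity f := by
  let r : I → Ω → ℝ := fun i ξ => ((ρ i).rnDeriv μ ξ).toReal
  have hrm : ∀ i, Measurable (r i) := fun i => (Measure.measurable_rnDeriv _ _).ennreal_toReal
  have hr : ∀ i, MemLp (r i) 1 μ := fun i =>
    memLp_one_iff_integrable.2 Measure.integrable_toReal_rnDeriv
  let φ : I → Lp ℝ 1 μ := fun i => (hr i).toLp (r i)
  have : Fact ((1 : ENNReal) ≠ ⊤) := ⟨ENNReal.one_ne_top⟩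
  have : SecondCountableTopology (Lp ℝ 1 μ) := inferInstance
  have : Nonempty (Set.range φ) := inferInstance
  let s := TopologicalSpace.denseSeq (Set.range φ)
  choose j hj using fun k => (s k).2
  let g : Ω → ℕ → ℝ := fun ξ k => r (j k) ξ
  have hg : Measurable g := measurable_pi_lambda _ fun k => hrm (j k)
  let mg : MeasurableSpace Ω := MeasurableSpace.comap g inferInstance
  have hle : mg ≤ mΩ := measurable_iff_comap_le.1 hg
  refine ⟨g, hg, fun i => ?_⟩
  -- Being a.e. measurable for `mg` is a closed condition in `L¹`, so it passes from the dense
  -- sequence to every density.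
  have hcl := isClosed_aestronglyMeasurable (F := ℝ) (p := 1) (μ := μ) hle
  have hs : ∀ k, AEStronglyMeasurable[mg] (s k : Lp ℝ 1 μ) μ := fun k => by
    have h1 : Measurable[mg] (r (j k)) :=
      Measurable.comp (g := fun a : ℕ → ℝ => a k) (measurable_pi_apply k) (comap_measurable g)
    rw [← hj k]
    exact AEStronglyMeasurable.congr ⟨_, h1.stronglyMeasurable, ae_eq_rfl⟩
      (hr (j k)).coeFn_toLp.symm
  have hi : AEStronglyMeasurable[mg] (φ i) μ := by
    have h1 : IsClosed {y : Set.range φ | AEStronglyMeasurable[mg] (y : Lp ℝ 1 μ) μ} :=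
      hcl.preimage continuous_subtype_val
    have h2 := (TopologicalSpace.denseRange_denseSeq (Set.range φ)).induction_on
      (p := fun y : Set.range φ => AEStronglyMeasurable[mg] (y : Lp ℝ 1 μ) μ)
      ⟨φ i, Set.mem_range_self i⟩ h1 hs
    exact h2
  obtain ⟨h, hh, hae⟩ := hi
  refine ⟨fun ξ => ENNReal.ofReal (h ξ), hh.measurable.ennreal_ofReal, ?_⟩
  rw [← Measure.withDensity_rnDeriv_eq _ _ (hρ i)]
  refine withDensity_congr_ae ?_
  filter_upwards [hae, (hr i).coeFn_toLp, Measure.rnDeriv_lt_top (ρ i) μ] with ξ h1 h2 h3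
  rw [← h1, h2, ENNReal.ofReal_toReal h3.ne]

/-- The measure with density `f` relative to `ν`, normalized; it is `ν` itself if this is
impossible. -/
noncomputable def reweight (f : Ω → ENNReal) (ν : Measure Ω) : Measure Ω :=
  open scoped Classical in
  if ∫⁻ η, f η ∂ν = 0 ∨ ∫⁻ η, f η ∂ν = ⊤ then ν
  else (∫⁻ η, f η ∂ν)⁻¹ • ν.withDensity f

/-- Through this, reweighted components inherit null sets, hence both the zero-one law and mutual
singularity. -/
lemma reweight_absolutelyContinuous (f : Ω → ENNReal) (ν : Measure Ω) : reweight f ν ≪ ν := by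
  unfold reweight
  split_ifs
  · exact Measure.AbsolutelyContinuous.rfl
  · exact (Measure.smul_absolutelyContinuous).trans (withDensity_absolutelyContinuous _ _)

instance (f : Ω → ENNReal) (ν : Measure Ω) [IsProbabilityMeasure ν] :
    IsProbabilityMeasure (reweight f ν) := by
  unfold reweight
  split_ifs with h
  · infer_instance
  · push Not at h
    refine ⟨?_⟩
    rw [Measure.smul_apply, withDensity_apply _ MeasurableSet.univ, Measure.restrict_univ,
      smul_eq_mul, ENNReal.inv_mul_cancel h.1 h.2]

lemma measurable_reweight {f : Ω → ENNReal} (hf : Measurable f) :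
    Measurable (reweight f : Measure Ω → Measure Ω) := by
  classical
  refine Measure.measurable_of_measurable_coe _ fun Δ hΔ => ?_
  have hZ : Measurable fun ν : Measure Ω => ∫⁻ η, f η ∂ν := Measure.measurable_lintegral hf
  have h1 : (fun ν : Measure Ω => reweight f ν Δ) = fun ν =>
      if ∫⁻ η, f η ∂ν = 0 ∨ ∫⁻ η, f η ∂ν = ⊤ then ν Δ
      else (∫⁻ η, f η ∂ν)⁻¹ * ∫⁻ η, Δ.indicator f η ∂ν := by
    funext ν
    unfold reweight
    split_ifs
    · rfl
    · rw [Measure.smul_apply, withDensity_apply _ hΔ, lintegral_indicator hΔ, smul_eq_mul]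
  rw [h1]
  refine Measurable.ite ?_ (Measure.measurable_coe hΔ)
    (hZ.inv.mul (Measure.measurable_lintegral (hf.indicator hΔ)))
  exact (hZ (measurableSet_singleton 0)).union (hZ (measurableSet_singleton ⊤))

/-- The product form also covers a vanishing normalization: both sides are then zero. -/
lemma reweight_mul_lintegral {f : Ω → ENNReal} {ν : Measure Ω}
    (hν : ∫⁻ η, f η ∂ν ≠ ⊤) {Δ : Set Ω} (hΔ : MeasurableSet Δ) :
    reweight f ν Δ * ∫⁻ η, f η ∂ν = ∫⁻ η, Δ.indicator f η ∂ν := by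
  unfold reweight
  rw [lintegral_indicator hΔ]
  split_ifs with h
  · have h0 : ∫⁻ η, f η ∂ν = 0 := h.resolve_right hν
    rw [h0, mul_zero]
    exact (le_antisymm ((setLIntegral_le_lintegral _ _).trans h0.le) zero_le).symm
  · push Not at h
    rw [Measure.smul_apply, withDensity_apply _ hΔ, smul_eq_mul, mul_comm, ← mul_assoc,
      ENNReal.mul_inv_cancel h.1 h.2, one_mul]

/-- A disintegration over `C` of a measure `μ` yields one of every measure with a density. -/
lemma setLIntegral_reweight_withDensity [IsProbabilityMeasure μ] (hC : C ≤ mΩ)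
    {q : Ω → Measure Ω} (hq : Measurable[C] q)
    (hdis : ∀ Δ Λ, MeasurableSet Δ → MeasurableSet[C] Λ → ∫⁻ ξ in Λ, q ξ Δ ∂μ = μ (Δ ∩ Λ))
    {f : Ω → ENNReal} (hf : Measurable f) (hfi : ∫⁻ ξ, f ξ ∂μ ≠ ⊤) {Δ Λ : Set Ω}
    (hΔ : MeasurableSet Δ) (hΛ : MeasurableSet[C] Λ) :
    ∫⁻ ξ in Λ, reweight f (q ξ) Δ ∂μ.withDensity f = μ.withDensity f (Δ ∩ Λ) := by
  have hqm : Measurable q := hq.mono hC le_rfl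
  have hone : Measurable[C] (Λ.indicator (1 : Ω → ENNReal)) :=
    Measurable.indicator (m := C) (@measurable_const _ _ _ C 1) hΛ
  have hκ : Measurable[C] fun ξ => reweight f (q ξ) Δ :=
    (Measure.measurable_coe hΔ).comp ((measurable_reweight hf).comp hq)
  have hZ : ∀ᵐ ξ ∂μ, ∫⁻ η, f η ∂q ξ < ⊤ := by
    refine ae_lt_top ((Measure.measurable_lintegral hf).comp hqm) ?_
    have := lintegral_mul_lintegral_disintegration hC hq hdis (@measurable_const _ _ _ C 1) hf
    simp only [one_mul] at this
    rwa [this]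
  have hc : Measurable[C] fun ξ => Λ.indicator 1 ξ * reweight f (q ξ) Δ := hone.mul hκ
  -- The reweighted probability is `C`-measurable, so `f` may be replaced by its average over `q ξ`,
  -- which cancels the normalization; a second exchange removes the inner integral.
  calc ∫⁻ ξ in Λ, reweight f (q ξ) Δ ∂μ.withDensity f
      = ∫⁻ ξ, (Λ.indicator 1 ξ * reweight f (q ξ) Δ) * f ξ ∂μ := by
        rw [← lintegral_indicator (hC _ hΛ), lintegral_withDensity_eq_lintegral_mul _ hf
          ((hκ.mono hC le_rfl).indicator (hC _ hΛ))]
        refine lintegral_congr fun ξ => ?_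
        by_cases h : ξ ∈ Λ <;> simp [h, mul_comm]
    _ = ∫⁻ ξ, (Λ.indicator 1 ξ * reweight f (q ξ) Δ) * ∫⁻ η, f η ∂q ξ ∂μ :=
        (lintegral_mul_lintegral_disintegration hC hq hdis hc hf).symm
    _ = ∫⁻ ξ, Λ.indicator 1 ξ * ∫⁻ η, Δ.indicator f η ∂q ξ ∂μ := by
        refine lintegral_congr_ae ?_
        filter_upwards [hZ] with ξ hξ
        rw [mul_assoc, reweight_mul_lintegral hξ.ne hΔ]
    _ = ∫⁻ ξ, Λ.indicator 1 ξ * Δ.indicator f ξ ∂μ :=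
        lintegral_mul_lintegral_disintegration hC hq hdis hone (hf.indicator hΔ)
    _ = μ.withDensity f (Δ ∩ Λ) := by
        rw [withDensity_apply _ (hΔ.inter (hC _ hΛ)),
          ← lintegral_indicator (hΔ.inter (hC _ hΛ))]
        refine lintegral_congr fun ξ => ?_
        by_cases h : ξ ∈ Λ <;> by_cases h' : ξ ∈ Δ <;> simp [h, h']

/-- Distinct measures that are concentrated on the set of their own points are mutually singular,
and so are the measures that they dominate. -/
lemma mutuallySingular_of_ae_eq {q : Ω → Measure Ω} (hq : ∀ ξ, ∀ᵐ η ∂q ξ, q η = q ξ)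
    {ξ ξ' : Ω} (h : q ξ ≠ q ξ') {ρ ρ' : Measure Ω} (hρ : ρ ≪ q ξ) (hρ' : ρ' ≪ q ξ') :
    ρ ⟂ₘ ρ' := by
  refine Measure.MutuallySingular.mk (s := {η | ¬ q η = q ξ}) (t := {η | ¬ q η = q ξ'})
    (hρ (hq ξ)) (hρ' (hq ξ')) fun η _ => ?_
  by_cases h1 : q η = q ξ
  · exact Or.inr fun h2 => h (h1.symm.trans h2)
  · exact Or.inl h1

end Components

/-! ### The decreasing σ-algebras of late outcomes -/

section TailSigma

variable {X : Type*} [MeasurableSpace X]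

lemma sigmaFrom_le (n : ℕ) : sigmaFrom X n ≤ MeasurableSpace.pi :=
  measurable_iff_comap_le.1 (measurable_pi_lambda _ fun _ => measurable_pi_apply _)

lemma antitone_sigmaFrom : Antitone (sigmaFrom X) := by
  intro n m hnm
  obtain ⟨k, rfl⟩ := Nat.exists_eq_add_of_le hnm
  refine measurable_iff_comap_le.1 ?_
  have h1 : Measurable fun (ξ : ℕ → X) (i : ℕ) => ξ (k + i) :=
    measurable_pi_lambda _ fun _ => measurable_pi_apply _
  have h2 : (fun (ξ : ℕ → X) (i : ℕ) => ξ (n + k + i)) =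
      (fun (ξ : ℕ → X) (i : ℕ) => ξ (k + i)) ∘ fun (ξ : ℕ → X) (i : ℕ) => ξ (n + i) := by
    funext ξ i
    simp [add_assoc]
  rw [h2]
  exact h1.comp (comap_measurable _)

end TailSigma

end IndirectMeasurement

-- The two decompositions

universe u v

/- The measures of all normal states are dominated by a single one. For the first part, the
dominating measure is disintegrated over a σ-algebra that contains the tail events and is sufficient
for the measures of all normal states, so that the components serve every state. For the second
part, it is disintegrated over the tail σ-algebra, and the components are reweighted by the density
of the state. Neither argument needs the decoherence of the measurements or the commutativity of
the asymptotic observables. -/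
open IndirectMeasurement in
theorem theorem1p6 {H : Type u} [NormedAddCommGroup H] [InnerProductSpace ℂ H] [CompleteSpace H]
    [TopologicalSpace.SeparableSpace H] {X : Type v} [Fintype X] [DecidableEq X]
    [MeasurableSpace X] [DiscreteMeasurableSpace X] (S : MonitoredSystem H X)
    (hdec : S.IdealDecoherence) (hab : S.AsymptoticallyAbelian) :
    -- one family of components for all normal states
    (∃ (N : Type v) (_ : MeasurableSpace N) (κ : Kernel N (ℕ → X)),
      (∀ ν, IsProbabilityMeasure (κ ν)) ∧
      (∀ ν ν', ν ≠ ν' → κ ν ⟂ₘ κ ν') ∧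
      (∀ ν, TailErgodic (κ ν)) ∧
      ∀ ω : NormalState S.observables, ∃ P : Measure N, IsProbabilityMeasure P ∧
        ∀ Δ : Set (ℕ → X), MeasurableSet Δ → S.historyMeasure ω Δ = ∫⁻ ν, κ ν Δ ∂P) ∧
    -- for each normal state, the disintegration over the tail σ-algebra
    (∃ (N : Type v) (mN : MeasurableSpace N) (p : (ℕ → X) → N),
      mN = (tailSigma X).map p ∧
      ∀ ω : NormalState S.observables, ∃ (P : Measure N) (κ : Kernel N (ℕ → X)),
        IsProbabilityMeasure P ∧
        P = (S.historyMeasure ω).map p ∧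
        (∀ ν, IsProbabilityMeasure (κ ν)) ∧
        (∀ ν ν', ν ≠ ν' → κ ν ⟂ₘ κ ν') ∧
        (∀ ν, TailErgodic (κ ν)) ∧
        (∀ Δ : Set (ℕ → X), MeasurableSet Δ → S.historyMeasure ω Δ = ∫⁻ ν, κ ν Δ ∂P) ∧
        ∀ Δ Λ : Set (ℕ → X), MeasurableSet Δ → MeasurableSet[tailSigma X] Λ →
          S.historyMeasure ω (Δ ∩ Λ) = ∫⁻ ξ in Λ, κ (p ξ) Δ ∂(S.historyMeasure ω)) := by
  rcases isEmpty_or_nonempty (NormalState S.observables) with hω | hω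
  · refine ⟨⟨PEmpty, ⊤, 0, fun ν => ν.elim, fun ν => ν.elim, fun ν => ν.elim,
      fun ω => hω.elim ω⟩, PUnit, _, fun _ => PUnit.unit, rfl, fun ω => hω.elim ω⟩
  obtain ⟨μ, hμ, hdom⟩ := S.exists_dominating_measure hω
  have hcgX : ∀ n, @MeasurableSpace.CountablyGenerated (ℕ → X) (sigmaFrom X n) := fun n =>
    MeasurableSpace.CountablyGenerated.comap _
  constructor
  · obtain ⟨g, hg, hsuff⟩ := exists_sufficient_statistic (fun ω => S.historyMeasure ω) hdom
    -- Each `B n` is countably generated. The intersection may exceed the join of the tail with `g`;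
    -- it need only contain both, the tail for ergodicity and `g` for sufficiency.
    let B : ℕ → MeasurableSpace (ℕ → X) := fun n =>
      sigmaFrom X n ⊔ MeasurableSpace.comap g inferInstance
    have hB : Antitone B := fun n m h => sup_le_sup_right (antitone_sigmaFrom h) _
    have hle : ∀ n, B n ≤ MeasurableSpace.pi := fun n =>
      sup_le (sigmaFrom_le n) (measurable_iff_comap_le.1 hg)
    have hcg : ∀ n, @MeasurableSpace.CountablyGenerated (ℕ → X) (B n) := fun n =>
      (hcgX n).sup (MeasurableSpace.CountablyGenerated.comap _)
    have hC : ⨅ n, B n ≤ MeasurableSpace.pi := (iInf_le B 0).trans (hle 0)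
    have htail : tailSigma X ≤ ⨅ n, B n := iInf_mono fun n => le_sup_left
    have hgB : MeasurableSpace.comap g inferInstance ≤ ⨅ n, B n := le_iInf fun n => le_sup_right
    obtain ⟨q, hq, hqp, hqe, hqc, hqd⟩ := exists_ergodic_disintegration μ hB hle hcg
    -- Indexing by the measures themselves makes distinct indices carry distinct, hence mutually
    -- singular, components.
    let p : (ℕ → X) → Set.range q := Set.rangeFactorization q
    let mN : MeasurableSpace (Set.range q) := (⨅ n, B n).map p
    have hp : Measurable p := fun s hs => hC _ hs
    let κ : Kernel (Set.range q) (ℕ → X) := ⟨fun ν => ν.1, fun s hs => hq hs⟩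
    refine ⟨Set.range q, mN, κ, ?_, ?_, ?_, fun ω => ⟨(S.historyMeasure ω).map p,
      Measure.isProbabilityMeasure_map hp.aemeasurable, fun Δ hΔ => ?_⟩⟩
    · rintro ⟨_, ξ, rfl⟩
      exact hqp ξ
    · rintro ⟨_, ξ, rfl⟩ ⟨_, ξ', rfl⟩ h
      exact mutuallySingular_of_ae_eq hqc (fun h' => h (Subtype.ext h'))
        Measure.AbsolutelyContinuous.rfl Measure.AbsolutelyContinuous.rfl
    · rintro ⟨_, ξ, rfl⟩ Λ hΛ
      exact hqe ξ Λ (htail _ hΛ)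
    · obtain ⟨f, hf, hωf⟩ := hsuff ω
      have hf' : Measurable[⨅ n, B n] f := hf.mono hgB le_rfl
      have hfm : Measurable f := hf'.mono hC le_rfl
      have hqΔ : Measurable fun ξ => q ξ Δ :=
        (Measure.measurable_coe hΔ).comp (hq.mono hC le_rfl)
      have key := lintegral_mul_lintegral_disintegration hC hq hqd hf'
        (measurable_one.indicator hΔ)
      simp only [lintegral_indicator_one hΔ] at key
      rw [lintegral_map (κ.measurable_coe hΔ) hp]
      change _ = ∫⁻ ξ, q ξ Δ ∂S.historyMeasure ω
      rw [hωf, lintegral_withDensity_eq_lintegral_mul _ hfm hqΔ, withDensity_apply _ hΔ,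
        ← lintegral_indicator hΔ]
      refine Eq.trans ?_ key.symm
      refine lintegral_congr fun ξ => ?_
      by_cases h : ξ ∈ Δ <;> simp [h]
  · obtain ⟨q, hq, hqp, hqe, hqc, hqd⟩ :=
      exists_ergodic_disintegration μ antitone_sigmaFrom (sigmaFrom_le (X := X)) hcgX
    have hC : tailSigma X ≤ MeasurableSpace.pi := (iInf_le _ 0).trans (sigmaFrom_le 0)
    -- The index set and `p` come from the components of `μ`, before `ω` is introduced; only the
    -- reweighting depends on `ω`.
    let p : (ℕ → X) → Set.range q := Set.rangeFactorization q
    refine ⟨Set.range q, (tailSigma X).map p, p, rfl, fun ω => ?_⟩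
    let mN : MeasurableSpace (Set.range q) := (tailSigma X).map p
    have hp : Measurable p := fun s hs => hC _ hs
    let f := (S.historyMeasure ω).rnDeriv μ
    have hf : Measurable f := Measure.measurable_rnDeriv _ _
    have hωf : μ.withDensity f = S.historyMeasure ω :=
      Measure.withDensity_rnDeriv_eq _ _ (hdom ω)
    have hfi : ∫⁻ ξ, f ξ ∂μ ≠ ⊤ := (Measure.lintegral_rnDeriv_lt_top _ _).ne
    let κ : Kernel (Set.range q) (ℕ → X) :=
      ⟨fun ν => reweight f ν.1, fun s hs => ((measurable_reweight hf).comp hq) hs⟩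
    have hdis : ∀ Δ Λ : Set (ℕ → X), MeasurableSet Δ → MeasurableSet[tailSigma X] Λ →
        S.historyMeasure ω (Δ ∩ Λ) = ∫⁻ ξ in Λ, κ (p ξ) Δ ∂(S.historyMeasure ω) := by
      intro Δ Λ hΔ hΛ
      have := setLIntegral_reweight_withDensity hC hq hqd hf hfi hΔ hΛ
      rw [hωf] at this
      exact this.symm
    refine ⟨(S.historyMeasure ω).map p, κ, Measure.isProbabilityMeasure_map hp.aemeasurable, rfl,
      ?_, ?_, ?_, fun Δ hΔ => ?_, hdis⟩
    · rintro ⟨_, ξ, rfl⟩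
      have := hqp ξ
      change IsProbabilityMeasure (reweight f (q ξ))
      infer_instance
    · rintro ⟨_, ξ, rfl⟩ ⟨_, ξ', rfl⟩ h
      exact mutuallySingular_of_ae_eq hqc (fun h' => h (Subtype.ext h'))
        (reweight_absolutelyContinuous _ _) (reweight_absolutelyContinuous _ _)
    · rintro ⟨_, ξ, rfl⟩ Λ hΛ
      have := hqp ξ
      have hac := reweight_absolutelyContinuous f (q ξ)
      rcases hqe ξ Λ hΛ with h | h
      · exact Or.inl (hac h)
      · right
        have h1 : q ξ Λᶜ = 0 := (prob_compl_eq_zero_iff (hC _ hΛ)).2 h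
        exact (prob_compl_eq_zero_iff (μ := reweight f (q ξ)) (hC _ hΛ)).1 (hac h1)
    · rw [lintegral_map (κ.measurable_coe hΔ) hp]
      simpa using hdis Δ Set.univ hΔ MeasurableSet.univ
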